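/- Let $X$ be a non-empty complete CAT(0) space, i.e. a complete geodesic metric space such that for all $x,c,c'\in X$ the midpoint $m$ of any geodesic between $c$ and $c'$ satisfies $2d^2(m,x)\le d^2(c',x)+d^2(c,x)-\tfrac12 d^2(c',c)$. Let $G=G_1\times\cdots\times G_n$ be a product of arbitrary topological groups, acting continuously by isometries on $X$. The action is called *evanescent* if there is an unbounded set $T\subseteq X$ such that for every compact set $Q\subseteq G$ the set $\{d(gx,x): g\in Q,\ x\in T\}$ is bounded. A non-empty closed convex invariant subspace is called *minimal* if it contains no strictly smaller one. Then either the $G$-action on $X$ is evanescent, or there is a canonical non-empty closed convex $G$-invariant subspace $Z\subseteq X$ which splits $G$-equivariantly and isometrically as a product of $G_i$-spaces. More precisely, in the second case: (a) Let $\mathcal T$ be the set of all minimal non-empty closed convex $G$-invariant subspaces of $X$, with the distance $d(C,C')=\inf\{d(x,y): x\in C,\ y\in C'\}$. Then there is exactly one $Z\in\mathcal T$ that is a circumcentre of $\mathcal T$, i.e. such that $\mathcal T$ lies in the closed ball around $Z$ of radius $\varrho$, where $\varrho<\infty$ is the smallest radius of a closed ball centred in $\mathcal T$ and containing $\mathcal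 T$. In particular $\varphi(Z)=Z$ for every isometry $\varphi$ of $X$ onto itself for which there is a group automorphism $\psi$ of $G$ with $\varphi(gx)=\psi(g)\varphi(x)$ for all $g\in G$, $x\in X$. (b) There are complete CAT(0) spaces $Z_1,\dots,Z_n$, each $Z_i$ with a continuous isometric action of $G_i$, and an isometry $\alpha$ of $Z$ onto the product $Z_1\times\cdots\times Z_n$ (with the metric $d^2(z,w)=\sum_i d^2(z_i,w_i)$), such that $\alpha(gz)_i=g_i\,\alpha(z)_i$ for all $g=(g_1,\dots,g_n)\in G$, $z\in Z$ and all $i$. Moreover each $Z_i$ is minimal: it has no non-empty closed convex $G_i$-invariant subset other than $Z_i$ itself. -/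

import Mathlib

namespace CatZero

/-- `γ`, restricted to `[0, dist x y]`, is a geodesic from `x` to `y`. -/
structure IsGeodesic {X : Type*} [MetricSpace X] (x y : X) (γ : ℝ → X) : Prop where
  source : γ 0 = x
  target : γ (dist x y) = y
  isometry : ∀ s ∈ Set.Icc 0 (dist x y), ∀ t ∈ Set.Icc 0 (dist x y),
    dist (γ s) (γ t) = |s - t|

/-- A CAT(0) space: a geodesic metric space satisfying the Bruhat-Tits inequality at the midpoint
of every geodesic. -/
structure IsCAT0 (X : Type*) [MetricSpace X] : Prop where
  exists_geodesic : ∀ x y : X, ∃ γ : ℝ → X, IsGeodesic x y γ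
  bruhat_tits : ∀ (x c c' : X) (γ : ℝ → X), IsGeodesic c c' γ →
    2 * dist (γ (dist c c' / 2)) x ^ 2 ≤
      dist c' x ^ 2 + dist c x ^ 2 - (1 / 2) * dist c' c ^ 2

/-- Geodesic convexity. -/
def IsGeodConvex {X : Type*} [MetricSpace X] (C : Set X) : Prop :=
  ∀ x ∈ C, ∀ y ∈ C, ∀ γ : ℝ → X, IsGeodesic x y γ → ∀ t ∈ Set.Icc 0 (dist x y), γ t ∈ C

/-- Evanescence of an action (meant for continuous actions by isometries). -/
def IsEvanescent (G X : Type*) [Group G] [TopologicalSpace G] [MetricSpace X] [MulAction G X] :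
    Prop :=
  ∃ T : Set X, ¬ Bornology.IsBounded T ∧
    ∀ Q : Set G, IsCompact Q →
      Bornology.IsBounded {r : ℝ | ∃ g ∈ Q, ∃ x ∈ T, r = dist (g • x) x}

/-- `C` is a non-empty closed convex `G`-invariant subspace of `X`. -/
structure IsInvariantSubspace (G : Type*) {X : Type*} [Group G] [MetricSpace X] [MulAction G X]
    (C : Set X) : Prop where
  nonempty : C.Nonempty
  isClosed : IsClosed C
  convex : IsGeodConvex C
  smul_mem : ∀ g : G, ∀ x ∈ C, g • x ∈ C

/-- `C` is minimal, for inclusion, among the non-empty closed convex `G`-invariant subspaces. -/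
def IsMinimalSubspace (G : Type*) {X : Type*} [Group G] [MetricSpace X] [MulAction G X]
    (C : Set X) : Prop :=
  Minimal (IsInvariantSubspace G) C

/-- The distance `d(C, C') = inf {d(x, y) : x ∈ C, y ∈ C'}` between two non-empty sets. -/
noncomputable def setDist {X : Type*} [MetricSpace X] (C C' : Set X) : ℝ :=
  sInf {r : ℝ | ∃ x ∈ C, ∃ y ∈ C', r = dist x y}

/-- `C₀` is a circumcentre of the space of components, that is, of the set of all minimal
non-empty closed convex `G`-invariant subspaces with the distance `setDist`: this set is contained
in the closed ball around `C₀` of radius `ρ`, where `ρ` is the smallest radius of a closed ball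
(centred at a component) that contains it. -/
def IsCentralComponent (G : Type*) {X : Type*} [Group G] [MetricSpace X] [MulAction G X]
    (C₀ : Set X) : Prop :=
  IsMinimalSubspace G C₀ ∧
    ∃ ρ : ℝ, (∀ C' : Set X, IsMinimalSubspace G C' → setDist C₀ C' ≤ ρ) ∧
      ∀ (C : Set X) (r : ℝ), IsMinimalSubspace G C →
        (∀ C' : Set X, IsMinimalSubspace G C' → setDist C C' ≤ r) → ρ ≤ r

end CatZero

universe u v

namespace CatZero

/-! ### Midpoint geometry of CAT(0) spaces. -/

section Basic

variable {X : Type*} [MetricSpace X]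

/-! Without evanescence, any set of points whose displacements are dominated by a continuous
function on `G` is bounded. Nearest-point projection to an invariant subspace is equivariant and
1-Lipschitz, so it never increases displacement. Nearest points along a chain of invariant subspaces
therefore stay bounded, and Zorn's lemma yields minimal subspaces
(`IsTame.exists_isMinimalSubspace`).

A continuous convex invariant function is constant on a minimal subspace
(`IsMinimalSubspace.eq_of_convex`). Applied to the distance to a second minimal subspace, this makes
the two parallel, with mutually inverse isometric projections. An equivariant self-embedding of a
minimal subspace is the identity, since otherwise its iterates would escape a bounded set. Hence the
projections compose without holonomy (`IsTame.proj_proj`), and the union of all minimal subspaces is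
closed and convex. Its fibre over one point is a bounded model of the space of components; the
circumcentre of that fibre singles out `Z`.

The splitting takes place inside `Z`. For a single factor the displacement sets may be unbounded,
but they are bounded within an orbit hull, where the commuting factors have controlled displacement
(`isTame_factor`). So `Z` is foliated by minimal subspaces of each factor. Each foliation splits off
a coordinate by Pythagoras, and what remains after all factors is an invariant map, constant by
minimality (`dist_sq_eq_sum`). -/

theorem IsCAT0.exists_mid (hX : IsCAT0 X) (x y : X) :
    ∃ m, dist x m = dist x y / 2 ∧ dist y m = dist x y / 2 ∧
      ∀ z, 2 * dist m z ^ 2 ≤ dist x z ^ 2 + dist y z ^ 2 - dist x y ^ 2 / 2 := by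
  obtain ⟨γ, h⟩ := hX.exists_geodesic x y
  have d0 : 0 ≤ dist x y := dist_nonneg
  have hm : dist x y / 2 ∈ Set.Icc 0 (dist x y) := ⟨by linarith, by linarith⟩
  refine ⟨γ (dist x y / 2), ?_, ?_, fun z => ?_⟩
  · have := h.isometry 0 ⟨le_rfl, d0⟩ _ hm
    rw [h.source] at this
    rw [this, zero_sub, abs_neg, abs_of_nonneg hm.1]
  · have := h.isometry (dist x y) ⟨d0, le_rfl⟩ _ hm
    rw [h.target] at this
    rw [this, abs_of_nonneg (by linarith)]
    ring
  · have := hX.bruhat_tits z x y γ h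
    rw [dist_comm y x] at this
    linarith

/-- The midpoint of two points of a CAT(0) space. -/
noncomputable def IsCAT0.mid (hX : IsCAT0 X) (x y : X) : X := (hX.exists_mid x y).choose

variable (hX : IsCAT0 X)
include hX

theorem IsCAT0.dist_left_mid (x y : X) : dist x (hX.mid x y) = dist x y / 2 :=
  (hX.exists_mid x y).choose_spec.1

theorem IsCAT0.dist_right_mid (x y : X) : dist y (hX.mid x y) = dist x y / 2 :=
  (hX.exists_mid x y).choose_spec.2.1

theorem IsCAT0.dist_mid_sq_le (x y z : X) :
    2 * dist (hX.mid x y) z ^ 2 ≤ dist x z ^ 2 + dist y z ^ 2 - dist x y ^ 2 / 2 :=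
  (hX.exists_mid x y).choose_spec.2.2 z

theorem IsCAT0.eq_mid {x y m : X} (h₁ : dist x m ≤ dist x y / 2) (h₂ : dist y m ≤ dist x y / 2) :
    m = hX.mid x y := by
  have h := hX.dist_mid_sq_le x y m
  have a := pow_le_pow_left₀ dist_nonneg h₁ 2
  have b := pow_le_pow_left₀ dist_nonneg h₂ 2
  have : dist (hX.mid x y) m ^ 2 ≤ 0 := by nlinarith
  have := pow_eq_zero_iff (two_ne_zero) |>.1 (le_antisymm this (sq_nonneg _))
  exact (dist_eq_zero.1 this).symm

theorem IsCAT0.mid_self (x : X) : hX.mid x x = x :=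
  (hX.eq_mid (by simp) (by simp)).symm

theorem IsCAT0.mid_comm (x y : X) : hX.mid x y = hX.mid y x :=
  hX.eq_mid (by rw [hX.dist_right_mid, dist_comm]) (by rw [hX.dist_left_mid, dist_comm])

/-- Apply the midpoint inequality twice, the second time to bound the distance from `y` to the other
midpoint; all terms except `dist y z` cancel. -/
theorem IsCAT0.dist_mid_mid_left_le (x y z : X) :
    dist (hX.mid x y) (hX.mid x z) ≤ dist y z / 2 := by
  have h₁ := hX.dist_mid_sq_le x y (hX.mid x z)
  have h₂ := hX.dist_mid_sq_le x z y
  rw [hX.dist_left_mid, dist_comm y] at h₁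
  rw [dist_comm z y] at h₂
  have : dist (hX.mid x y) (hX.mid x z) ^ 2 ≤ (dist y z / 2) ^ 2 := by nlinarith
  exact le_of_sq_le_sq this (by positivity)

theorem IsCAT0.dist_mid_mid_le (x y x' y' : X) :
    dist (hX.mid x y) (hX.mid x' y') ≤ (dist x x' + dist y y') / 2 := by
  have h₁ := hX.dist_mid_mid_left_le x y y'
  have h₂ := hX.dist_mid_mid_left_le y' x x'
  rw [hX.mid_comm y' x, hX.mid_comm y' x'] at h₂
  linarith [dist_triangle (hX.mid x y) (hX.mid x y') (hX.mid x' y')]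

/-- The quadrilateral inequality. -/
theorem IsCAT0.quadrilateral (a b c d : X) :
    dist a c ^ 2 + dist b d ^ 2 ≤ dist a b ^ 2 + dist b c ^ 2 + dist c d ^ 2 + dist d a ^ 2 := by
  have h₁ := hX.dist_mid_sq_le a c b
  have h₂ := hX.dist_mid_sq_le a c d
  have h₃ := dist_triangle_left b d (hX.mid a c)
  have h₄ := pow_le_pow_left₀ dist_nonneg h₃ 2
  rw [dist_comm c b] at h₁
  rw [dist_comm a d] at h₂
  nlinarith [sq_nonneg (dist (hX.mid a c) b - dist (hX.mid a c) d)]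

theorem IsCAT0.map_mid {Y : Type*} [MetricSpace Y] (hY : IsCAT0 Y) {f : X → Y} {x y : X}
    (h : dist (f x) (f y) = dist x y)
    (h₁ : dist (f x) (f (hX.mid x y)) ≤ dist x (hX.mid x y))
    (h₂ : dist (f y) (f (hX.mid x y)) ≤ dist y (hX.mid x y)) :
    f (hX.mid x y) = hY.mid (f x) (f y) := by
  rw [hX.dist_left_mid] at h₁
  rw [hX.dist_right_mid] at h₂
  exact hY.eq_mid (by rwa [h]) (by rwa [h])

theorem IsCAT0.geodesic_mid {x y : X} {γ : ℝ → X} (h : IsGeodesic x y γ) {s t : ℝ}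
    (hs : s ∈ Set.Icc 0 (dist x y)) (ht : t ∈ Set.Icc 0 (dist x y)) :
    γ ((s + t) / 2) = hX.mid (γ s) (γ t) := by
  have hm : (s + t) / 2 ∈ Set.Icc 0 (dist x y) :=
    ⟨by linarith [hs.1, ht.1], by linarith [hs.2, ht.2]⟩
  have e : |s - t| / 2 = |(s - t) / 2| := by rw [abs_div, abs_two]
  apply hX.eq_mid
  · rw [h.isometry _ hs _ hm, h.isometry _ hs _ ht, e]
    exact le_of_eq (by congr 1; ring)
  · rw [h.isometry _ ht _ hm, h.isometry _ hs _ ht, e, abs_sub_comm]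
    exact le_of_eq (by congr 1; ring)

/-- Convexity with respect to midpoints. -/
def IsCAT0.MidConvex (hX : IsCAT0 X) (C : Set X) : Prop := ∀ x ∈ C, ∀ y ∈ C, hX.mid x y ∈ C

theorem IsCAT0.midConvex_of_isGeodConvex {C : Set X} (hC : IsGeodConvex C) : hX.MidConvex C := by
  intro x hx y hy
  obtain ⟨γ, h⟩ := hX.exists_geodesic x y
  have d0 : 0 ≤ dist x y := dist_nonneg
  have := hX.geodesic_mid h ⟨le_rfl, d0⟩ ⟨d0, le_rfl⟩
  rw [h.source, h.target] at this
  rw [← this]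
  exact hC x hx y hy γ h _ ⟨by linarith, by linarith⟩

/-- A parameter leaving `C` would lie in a maximal open gap, whose endpoints belong to `C` by
closedness; the midpoint of the gap then belongs to `C` too. This allows midpoints to replace
geodesics in all later arguments. -/
theorem IsCAT0.isGeodConvex_of_midConvex {C : Set X} (hC : IsClosed C) (hm : hX.MidConvex C) :
    IsGeodConvex C := by
  intro x hx y hy γ h t₀ ht₀
  by_contra hn
  have d0 : 0 ≤ dist x y := dist_nonneg
  have hcont : ContinuousOn γ (Set.Icc 0 (dist x y)) := by
    have : LipschitzOnWith 1 γ (Set.Icc 0 (dist x y)) :=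
      LipschitzOnWith.of_dist_le_mul fun s hs t ht => by
        rw [h.isometry s hs t ht, Real.dist_eq]; simp
    exact this.continuousOn
  set A : Set ℝ := Set.Icc 0 (dist x y) ∩ γ ⁻¹' C with hA
  have hAc : IsClosed A := hcont.preimage_isClosed_of_isClosed isClosed_Icc hC
  have h0 : (0 : ℝ) ∈ A := ⟨⟨le_rfl, d0⟩, by simpa [h.source] using hx⟩
  have h1 : dist x y ∈ A := ⟨⟨d0, le_rfl⟩, by simpa [h.target] using hy⟩
  have bA : BddAbove (A ∩ Set.Iic t₀) := ⟨t₀, fun _ hs => hs.2⟩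
  have bB : BddBelow (A ∩ Set.Ici t₀) := ⟨t₀, fun _ hs => hs.2⟩
  have ha := (hAc.inter isClosed_Iic).csSup_mem ⟨0, h0, ht₀.1⟩ bA
  have hb := (hAc.inter isClosed_Ici).csInf_mem ⟨_, h1, ht₀.2⟩ bB
  set a := sSup (A ∩ Set.Iic t₀)
  set b := sInf (A ∩ Set.Ici t₀)
  have ha' : a < t₀ := lt_of_le_of_ne ha.2 (by rintro e; exact hn (e ▸ ha.1.2))
  have hb' : t₀ < b := lt_of_le_of_ne hb.2 (by rintro e; exact hn (e ▸ hb.1.2))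
  have hmid : (a + b) / 2 ∈ A := by
    refine ⟨⟨by linarith [ha.1.1.1, hb.1.1.1], by linarith [ha.1.1.2, hb.1.1.2]⟩, ?_⟩
    show γ _ ∈ C
    rw [hX.geodesic_mid h ha.1.1 hb.1.1]
    exact hm _ ha.1.2 _ hb.1.2
  rcases le_total ((a + b) / 2) t₀ with hle | hle
  · linarith [le_csSup bA ⟨hmid, hle⟩]
  · linarith [csInf_le bB ⟨hmid, hle⟩]

end Basic

/-! ### Nearest points, circumcentres and chains of closed convex sets. -/

section Projection

variable {X : Type*} [MetricSpace X]

open Classical in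
/-- The nearest-point projection to `C` (the identity if there is no nearest point). -/
noncomputable def proj (C : Set X) (x : X) : X :=
  if h : ∃ p ∈ C, ∀ c ∈ C, dist x p ≤ dist x c then h.choose else x

/-- A non-empty closed midpoint-convex subset. -/
structure IsCAT0.ClosedConvex (hX : IsCAT0 X) (C : Set X) : Prop where
  nonempty : C.Nonempty
  isClosed : IsClosed C
  mid_mem : hX.MidConvex C

variable {hX : IsCAT0 X} {C : Set X}

theorem IsCAT0.ClosedConvex.dist_sq_add_le_of_nearest (hC : hX.ClosedConvex C) {x p c : X}
    (hp : p ∈ C) (hmin : ∀ c ∈ C, dist x p ≤ dist x c) (hc : c ∈ C) :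
    dist x p ^ 2 + dist p c ^ 2 ≤ dist x c ^ 2 := by
  -- Repeated halving towards `p` gives points of `C` at dyadic fractions. Comparing with minimality
  -- of `p`, dividing by `(1 / 2) ^ k` and letting `k` grow gives the Pythagorean inequality with
  -- constant 1.
  have key : ∀ k : ℕ, ∃ q ∈ C, dist p q = dist p c * (1 / 2) ^ k ∧
      dist x q ^ 2 ≤ (1 - (1 / 2) ^ k) * dist x p ^ 2 + (1 / 2) ^ k * dist x c ^ 2
        - (1 / 2) ^ k * (1 - (1 / 2) ^ k) * dist p c ^ 2 := by
    intro k
    induction k with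
    | zero => exact ⟨c, hc, by simp, by simp⟩
    | succ k ih =>
      obtain ⟨q, hq, h₁, h₂⟩ := ih
      refine ⟨hX.mid p q, hC.mid_mem _ hp _ hq, ?_, ?_⟩
      · rw [hX.dist_left_mid, h₁]; ring
      · have := hX.dist_mid_sq_le p q x
        rw [dist_comm _ x, dist_comm _ x, dist_comm _ x, h₁] at this
        rw [pow_succ (1 / 2 : ℝ)]
        nlinarith
  have lim : Filter.Tendsto (fun k : ℕ => dist x p ^ 2 + (1 - (1 / 2 : ℝ) ^ k) * dist p c ^ 2)
      Filter.atTop (nhds (dist x p ^ 2 + (1 - 0) * dist p c ^ 2)) := by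
    have := tendsto_pow_atTop_nhds_zero_of_lt_one (r := (1 / 2 : ℝ)) (by norm_num) (by norm_num)
    exact tendsto_const_nhds.add ((tendsto_const_nhds.sub this).mul tendsto_const_nhds)
  have := le_of_tendsto' lim (b := dist x c ^ 2) fun k => by
    obtain ⟨q, hq, -, h₂⟩ := key k
    have h₃ := pow_le_pow_left₀ dist_nonneg (hmin q hq) 2
    have pos : (0 : ℝ) < (1 / 2) ^ k := by positivity
    by_contra hlt
    push Not at hlt
    nlinarith [mul_lt_mul_of_pos_left hlt pos]
  simpa using this

theorem IsCAT0.ClosedConvex.exists_nearest [CompleteSpace X] (hC : hX.ClosedConvex C) (x : X) :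
    ∃ p ∈ C, ∀ c ∈ C, dist x p ≤ dist x c := by
  have hne := hC.nonempty
  set r := Metric.infDist x C
  have hr : ∀ c ∈ C, r ≤ dist x c := fun c hc => Metric.infDist_le_dist_of_mem hc
  have hr0 : 0 ≤ r := Metric.infDist_nonneg
  have hex : ∀ k : ℕ, ∃ c ∈ C, dist x c ^ 2 < r ^ 2 + (1 / 2) ^ k := by
    intro k
    have hlt : r < Real.sqrt (r ^ 2 + (1 / 2) ^ k) :=
      Real.lt_sqrt_of_sq_lt (by have : (0 : ℝ) < (1 / 2) ^ k := by positivity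
                                linarith)
    obtain ⟨c, hc, h⟩ := (Metric.infDist_lt_iff hne).1 hlt
    exact ⟨c, hc, (Real.lt_sqrt dist_nonneg).1 h⟩
  choose c hcC hc using hex
  have hclose : ∀ k l, dist (c k) (c l) ^ 2 ≤ 2 * ((1 / 2) ^ k + (1 / 2) ^ l) := by
    intro k l
    have h₁ := hX.dist_mid_sq_le (c k) (c l) x
    have h₂ := pow_le_pow_left₀ hr0 (hr _ (hC.mid_mem _ (hcC k) _ (hcC l))) 2
    rw [dist_comm _ x, dist_comm _ x, dist_comm _ x] at h₁
    linarith [hc k, hc l]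
  have hcau : CauchySeq c := by
    rw [Metric.cauchySeq_iff]
    intro ε hε
    have := tendsto_pow_atTop_nhds_zero_of_lt_one (r := (1 / 2 : ℝ)) (by norm_num) (by norm_num)
    have hev := this.eventually (gt_mem_nhds (show 0 < ε ^ 2 / 4 by positivity))
    obtain ⟨N, hN⟩ := Filter.eventually_atTop.1 hev
    refine ⟨N, fun k hk l hl => ?_⟩
    refine lt_of_pow_lt_pow_left₀ 2 hε.le ?_
    linarith [hclose k l, hN k hk, hN l hl]
  obtain ⟨p, hp⟩ := cauchySeq_tendsto_of_complete hcau
  refine ⟨p, hC.isClosed.mem_of_tendsto hp (Filter.Eventually.of_forall hcC), fun q hq => ?_⟩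
  have hlim : Filter.Tendsto (fun k => dist x (c k) ^ 2) Filter.atTop (nhds (dist x p ^ 2)) :=
    (tendsto_const_nhds.dist hp).pow 2
  have hlim' : Filter.Tendsto (fun k : ℕ => r ^ 2 + (1 / 2 : ℝ) ^ k) Filter.atTop
      (nhds (r ^ 2 + 0)) := tendsto_const_nhds.add
    (tendsto_pow_atTop_nhds_zero_of_lt_one (by norm_num) (by norm_num))
  have hle := le_of_tendsto_of_tendsto' hlim hlim' fun k => (hc k).le
  rw [add_zero] at hle
  exact (le_of_sq_le_sq hle hr0).trans (hr q hq)

variable [CompleteSpace X] (hC : hX.ClosedConvex C)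
include hC

theorem IsCAT0.ClosedConvex.proj_mem (x : X) : proj C x ∈ C := by
  have h := hC.exists_nearest x
  rw [proj, dif_pos h]
  exact h.choose_spec.1

theorem IsCAT0.ClosedConvex.dist_proj_le (x : X) {c : X} (hc : c ∈ C) :
    dist x (proj C x) ≤ dist x c := by
  have h := hC.exists_nearest x
  rw [proj, dif_pos h]
  exact h.choose_spec.2 c hc

theorem IsCAT0.ClosedConvex.dist_proj_sq_add_le (x : X) {c : X} (hc : c ∈ C) :
    dist x (proj C x) ^ 2 + dist (proj C x) c ^ 2 ≤ dist x c ^ 2 :=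
  hC.dist_sq_add_le_of_nearest (hC.proj_mem x) (fun _ => hC.dist_proj_le x) hc

theorem IsCAT0.ClosedConvex.eq_proj {x p : X} (hp : p ∈ C) (h : dist x p ≤ dist x (proj C x)) :
    p = proj C x := by
  have h₁ := hC.dist_proj_sq_add_le x hp
  have h₂ := pow_le_pow_left₀ dist_nonneg h 2
  have : dist (proj C x) p ^ 2 ≤ 0 := by linarith
  have := pow_eq_zero_iff (two_ne_zero) |>.1 (le_antisymm this (sq_nonneg _))
  exact (dist_eq_zero.1 this).symm

/-- Add the Pythagorean inequalities at both projections and cancel with the quadrilateral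
inequality. -/
theorem IsCAT0.ClosedConvex.dist_proj_proj_le (x y : X) :
    dist (proj C x) (proj C y) ≤ dist x y := by
  have h₁ := hC.dist_proj_sq_add_le x (hC.proj_mem y)
  have h₂ := hC.dist_proj_sq_add_le y (hC.proj_mem x)
  have h₃ := hX.quadrilateral x (proj C x) (proj C y) y
  rw [dist_comm (proj C y) (proj C x)] at h₂
  rw [dist_comm (proj C x) y, dist_comm (proj C y) y, dist_comm y x] at h₃
  exact le_of_sq_le_sq (by linarith) dist_nonneg

theorem IsCAT0.ClosedConvex.continuous_proj : Continuous (proj C) :=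
  (LipschitzWith.of_dist_le_mul (K := 1) fun x y => by
    simpa using hC.dist_proj_proj_le x y).continuous

theorem IsCAT0.ClosedConvex.dist_mid_proj_le (x y : X) :
    dist (hX.mid x y) (proj C (hX.mid x y)) ≤
      (dist x (proj C x) + dist y (proj C y)) / 2 :=
  (hC.dist_proj_le _ (hC.mid_mem _ (hC.proj_mem x) _ (hC.proj_mem y))).trans
    (hX.dist_mid_mid_le _ _ _ _)

/-- A bounded closed convex subset has a unique circumcentre in itself. -/
theorem IsCAT0.ClosedConvex.exists_circumcentre (hb : Bornology.IsBounded C) :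
    ∃ z ∈ C, ∃ ρ : ℝ, (∀ y ∈ C, dist z y ≤ ρ) ∧
      (∀ w ∈ C, ∀ r : ℝ, (∀ y ∈ C, dist w y ≤ r) → ρ ≤ r) ∧
      ∀ w ∈ C, (∀ y ∈ C, dist w y ≤ ρ) → w = z := by
  obtain ⟨B, hB⟩ := Metric.isBounded_iff.1 hb
  obtain ⟨x₀, hx₀⟩ := hC.nonempty
  set V : Set ℝ := {r | ∃ w ∈ C, ∀ y ∈ C, dist w y ≤ r}
  have hVne : V.Nonempty := ⟨B, x₀, hx₀, fun y hy => hB hx₀ hy⟩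
  have hpos : ∀ r ∈ V, 0 ≤ r := fun r ⟨w, hw, h⟩ => dist_nonneg.trans (h w hw)
  have hVb : BddBelow V := ⟨0, hpos⟩
  set ρ := sInf V
  have hρ : 0 ≤ ρ := le_csInf hVne hpos
  -- The midpoint of two near-optimal centres improves the squared radius by a quarter of their
  -- squared distance, yet cannot beat `ρ`. This yields both convergence and uniqueness.
  have hclose : ∀ w ∈ C, ∀ w' ∈ C, ∀ s, (∀ y ∈ C, dist w y ^ 2 ≤ s) →
      (∀ y ∈ C, dist w' y ^ 2 ≤ s) → dist w w' ^ 2 ≤ 4 * (s - ρ ^ 2) := by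
    intro w hw w' hw' s hs hs'
    have hm := hC.mid_mem _ hw _ hw'
    have hub : ∀ y ∈ C, dist (hX.mid w w') y ^ 2 ≤ s - dist w w' ^ 2 / 4 := fun y hy => by
      linarith [hX.dist_mid_sq_le w w' y, hs y hy, hs' y hy]
    have h0 : 0 ≤ s - dist w w' ^ 2 / 4 := (sq_nonneg _).trans (hub _ hm)
    have : ρ ≤ Real.sqrt (s - dist w w' ^ 2 / 4) :=
      csInf_le hVb ⟨_, hm, fun y hy => Real.le_sqrt_of_sq_le (hub y hy)⟩
    have := pow_le_pow_left₀ hρ this 2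
    rw [Real.sq_sqrt h0] at this
    linarith
  obtain ⟨u, hanti, hu, huV⟩ := exists_seq_tendsto_sInf hVne hVb
  change Filter.Tendsto u Filter.atTop (nhds ρ) at hu
  choose w hwC hw using huV
  have hu2 : Filter.Tendsto (fun k => 4 * (u k ^ 2 - ρ ^ 2)) Filter.atTop (nhds 0) := by
    have := ((hu.pow 2).sub_const (ρ ^ 2)).const_mul 4
    rwa [sub_self, mul_zero] at this
  have hle : ∀ N, ∀ k ≥ N, ∀ y ∈ C, dist (w k) y ^ 2 ≤ u N ^ 2 := fun N k hk y hy =>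
    pow_le_pow_left₀ dist_nonneg ((hw k y hy).trans (hanti hk)) 2
  have hcau : CauchySeq w := by
    rw [Metric.cauchySeq_iff]
    intro ε hε
    obtain ⟨N, hN⟩ := (hu2.eventually (gt_mem_nhds (show 0 < ε ^ 2 by positivity))).exists
    refine ⟨N, fun k hk l hl => lt_of_pow_lt_pow_left₀ 2 hε.le ?_⟩
    exact (hclose _ (hwC k) _ (hwC l) _ (hle N k hk) (hle N l hl)).trans_lt hN
  obtain ⟨z, hz⟩ := cauchySeq_tendsto_of_complete hcau
  have hzC : z ∈ C := hC.isClosed.mem_of_tendsto hz (Filter.Eventually.of_forall hwC)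
  have hzρ : ∀ y ∈ C, dist z y ≤ ρ := fun y hy =>
    le_of_tendsto_of_tendsto' (hz.dist tendsto_const_nhds) hu fun k => hw k y hy
  refine ⟨z, hzC, ρ, hzρ, fun w hw r h => csInf_le hVb ⟨w, hw, h⟩, fun w hw h => ?_⟩
  have := hclose w hw z hzC (ρ ^ 2) (fun y hy => pow_le_pow_left₀ dist_nonneg (h y hy) 2)
    (fun y hy => pow_le_pow_left₀ dist_nonneg (hzρ y hy) 2)
  rw [sub_self, mul_zero] at this
  exact dist_eq_zero.1 (pow_eq_zero_iff two_ne_zero |>.1 (le_antisymm this (sq_nonneg _)))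

omit hC in
/-- A chain of closed convex subsets whose nearest points to `x` stay bounded has a common
point. -/
theorem IsCAT0.chain_inter_nonempty {c : Set (Set X)} (hc : IsChain (· ⊆ ·) c)
    (hne : c.Nonempty) (hconv : ∀ D ∈ c, hX.ClosedConvex D) (x : X) {R : ℝ}
    (hR : ∀ D ∈ c, dist x (proj D x) ≤ R) : (⋂₀ c).Nonempty := by
  have hmono : ∀ D ∈ c, ∀ E ∈ c, D ⊆ E →
      dist (proj D x) (proj E x) ^ 2 ≤ dist x (proj D x) ^ 2 - dist x (proj E x) ^ 2 := by
    intro D hD E hE hDE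
    have := (hconv E hE).dist_proj_sq_add_le x (hDE ((hconv D hD).proj_mem x))
    rw [dist_comm (proj D x)]
    linarith
  have hdist : ∀ D ∈ c, ∀ E ∈ c,
      dist (proj D x) (proj E x) ^ 2 ≤ |dist x (proj D x) ^ 2 - dist x (proj E x) ^ 2| := by
    intro D hD E hE
    rcases hc.total hD hE with h | h
    · exact (hmono D hD E hE h).trans (le_abs_self _)
    · rw [dist_comm, abs_sub_comm]
      exact (hmono E hE D hD h).trans (le_abs_self _)
  set V : Set ℝ := (fun D => dist x (proj D x) ^ 2) '' c
  have hV : BddAbove V := ⟨R ^ 2, by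
    rintro _ ⟨D, hD, rfl⟩
    exact pow_le_pow_left₀ dist_nonneg (hR D hD) 2⟩
  have hVne : V.Nonempty := hne.image _
  obtain ⟨u, -, hu, huV⟩ := exists_seq_tendsto_sSup hVne hV
  choose D hD hDu using huV
  have hDu' : Filter.Tendsto (fun k => dist x (proj (D k) x) ^ 2) Filter.atTop
      (nhds (sSup V)) := by
    convert hu using 1
    exact funext hDu
  have hcau : CauchySeq fun k => proj (D k) x := by
    rw [Metric.cauchySeq_iff]
    intro ε hε
    obtain ⟨N, hN⟩ := Metric.cauchySeq_iff.1 hDu'.cauchySeq (ε ^ 2) (by positivity)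
    refine ⟨N, fun k hk l hl => lt_of_pow_lt_pow_left₀ 2 hε.le ?_⟩
    exact (hdist _ (hD k) _ (hD l)).trans_lt (hN k hk l hl)
  obtain ⟨q, hq⟩ := cauchySeq_tendsto_of_complete hcau
  refine ⟨q, fun E hE => ?_⟩
  -- Either `q` is a limit of points of `E`, or `E` lies below almost all `D k`; in the latter case
  -- the squared distances are squeezed to the supremum and `q` is the projection to `E`.
  by_cases hfr : ∃ᶠ k in Filter.atTop, D k ⊆ E
  · exact (hconv E hE).isClosed.mem_of_frequently_of_tendsto
      (hfr.mono fun k hk => hk ((hconv _ (hD k)).proj_mem x)) hq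
  · have hev : ∀ᶠ k in Filter.atTop, E ⊆ D k := by
      filter_upwards [Filter.not_frequently.1 hfr] with k hk
      exact (hc.total hE (hD k)).resolve_right hk
    have hsup : dist x (proj E x) ^ 2 ≤ sSup V := le_csSup hV ⟨E, hE, rfl⟩
    have hto : Filter.Tendsto (fun k => dist (proj E x) (proj (D k) x) ^ 2) Filter.atTop
        (nhds 0) := by
      have hz : Filter.Tendsto (fun k => sSup V - dist x (proj (D k) x) ^ 2) Filter.atTop
          (nhds 0) := by simpa using (tendsto_const_nhds (x := sSup V)).sub hDu'
      refine tendsto_of_tendsto_of_tendsto_of_le_of_le' tendsto_const_nhds hz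
        (Filter.Eventually.of_forall fun k => sq_nonneg _) ?_
      filter_upwards [hev] with k hk
      linarith [hmono E hE _ (hD k) hk]
    have hlim := ((tendsto_const_nhds (x := proj E x)).dist hq).pow 2
    have h0 := tendsto_nhds_unique hlim hto
    rw [← dist_eq_zero.1 (pow_eq_zero_iff two_ne_zero |>.1 h0)]
    exact (hconv E hE).proj_mem x

end Projection

/-! ### Invariant and minimal subspaces. -/

section Invariant

variable {H X : Type*} [Group H] [MetricSpace X] [MulAction H X] {C C' : Set X}

theorem IsInvariantSubspace.closedConvex (hC : IsInvariantSubspace H C) (hX : IsCAT0 X) :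
    hX.ClosedConvex C :=
  ⟨hC.nonempty, hC.isClosed, hX.midConvex_of_isGeodConvex hC.convex⟩

theorem IsCAT0.ClosedConvex.isInvariantSubspace {hX : IsCAT0 X} (hC : hX.ClosedConvex C)
    (h : ∀ g : H, ∀ x ∈ C, g • x ∈ C) : IsInvariantSubspace H C :=
  ⟨hC.nonempty, hC.isClosed, hX.isGeodConvex_of_midConvex hC.isClosed hC.mid_mem, h⟩

variable (H) in
/-- The smallest closed convex invariant subspace containing `x`. -/
def orbitHull (x : X) : Set X := ⋂₀ {C | IsInvariantSubspace H C ∧ x ∈ C}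

variable (H) in
/-- The points that are displaced by `H` at most as much as `x`. -/
def subDisplacement (x : X) : Set X := {t | ∀ h : H, dist (h • t) t ≤ dist (h • x) x}

theorem mem_orbitHull (x : X) : x ∈ orbitHull H x := fun _ hC => hC.2

theorem orbitHull_subset (hC : IsInvariantSubspace H C) {x : X} (hx : x ∈ C) :
    orbitHull H x ⊆ C := fun _ ht => ht C ⟨hC, hx⟩

theorem IsInvariantSubspace.orbitHull (hX : IsCAT0 X) (x : X) :
    IsInvariantSubspace H (orbitHull H x) := by
  refine IsCAT0.ClosedConvex.isInvariantSubspace (hX := hX) ⟨⟨x, mem_orbitHull x⟩, ?_, ?_⟩ ?_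
  · exact isClosed_sInter fun C hC => hC.1.isClosed
  · exact fun y hy z hz C hC => (hC.1.closedConvex hX).mid_mem _ (hy C hC) _ (hz C hC)
  · exact fun g y hy C hC => hC.1.smul_mem g y (hy C hC)

theorem IsMinimalSubspace.eq_orbitHull (hC : IsMinimalSubspace H C) (hX : IsCAT0 X) {x : X}
    (hx : x ∈ C) : C = orbitHull H x :=
  (hC.2 (IsInvariantSubspace.orbitHull hX x) (orbitHull_subset hC.1 hx)).antisymm
    (orbitHull_subset hC.1 hx)

theorem IsMinimalSubspace.subset_of_midConvex (hC : IsMinimalSubspace H C) (hX : IsCAT0 X)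
    {E : Set X} (hne : (C ∩ E).Nonempty) (hcl : IsClosed E)
    (hmid : ∀ x ∈ C, x ∈ E → ∀ y ∈ C, y ∈ E → hX.mid x y ∈ E)
    (hinv : ∀ h : H, ∀ x ∈ C, x ∈ E → h • x ∈ E) : C ⊆ E := by
  have hCC := hC.1.closedConvex hX
  have : IsInvariantSubspace H (C ∩ E) := by
    refine IsCAT0.ClosedConvex.isInvariantSubspace (hX := hX)
      ⟨hne, hCC.isClosed.inter hcl, ?_⟩ ?_
    · exact fun x hx y hy => ⟨hCC.mid_mem _ hx.1 _ hy.1, hmid _ hx.1 hx.2 _ hy.1 hy.2⟩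
    · exact fun g x hx => ⟨hC.1.smul_mem g x hx.1, hinv g x hx.1 hx.2⟩
  exact (hC.2 this Set.inter_subset_left).trans Set.inter_subset_right

/-- Each sublevel set through a point of `C` is closed, convex and invariant, hence all of `C`. -/
theorem IsMinimalSubspace.eq_of_convex (hC : IsMinimalSubspace H C) (hX : IsCAT0 X) {f : X → ℝ}
    (hf : ContinuousOn f C)
    (hmid : ∀ x ∈ C, ∀ y ∈ C, f (hX.mid x y) ≤ (f x + f y) / 2)
    (hinv : ∀ h : H, ∀ x ∈ C, f (h • x) = f x) {x y : X} (hx : x ∈ C) (hy : y ∈ C) :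
    f x = f y := by
  have key : ∀ y ∈ C, ∀ x ∈ C, f x ≤ f y := by
    intro y hy
    have := hC.subset_of_midConvex hX (E := C ∩ f ⁻¹' Set.Iic (f y)) ⟨y, hy, hy, le_refl (f y)⟩
      (hf.preimage_isClosed_of_isClosed hC.1.isClosed isClosed_Iic) ?_ ?_
    · exact fun x hx => (this hx).2
    · rintro a ha ⟨-, ha'⟩ b hb ⟨-, hb'⟩
      refine ⟨(hC.1.closedConvex hX).mid_mem _ ha _ hb, (hmid a ha b hb).trans ?_⟩
      rw [Set.mem_preimage, Set.mem_Iic] at ha' hb'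
      linarith
    · rintro h a ha ⟨-, ha'⟩
      exact ⟨hC.1.smul_mem h a ha, (hinv h a ha).trans_le ha'⟩
  exact le_antisymm (key y hy x hx) (key x hx y hy)

variable (H) in
/-- `f` restricts to an `H`-equivariant isometric embedding of `C`. -/
structure IsEquivIsomOn (C : Set X) (f : X → X) : Prop where
  dist_eq : ∀ x ∈ C, ∀ y ∈ C, dist (f x) (f y) = dist x y
  map_smul : ∀ h : H, ∀ x ∈ C, f (h • x) = h • f x

theorem IsEquivIsomOn.comp {f g : X → X} (hg : IsEquivIsomOn H C' g) (hf : IsEquivIsomOn H C f)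
    (hm : Set.MapsTo f C C') : IsEquivIsomOn H C (g ∘ f) where
  dist_eq x hx y hy := (hg.dist_eq _ (hm hx) _ (hm hy)).trans (hf.dist_eq x hx y hy)
  map_smul h x hx := by
    simp only [Function.comp]
    rw [hf.map_smul h x hx, hg.map_smul h _ (hm hx)]

theorem IsEquivIsomOn.continuousOn {f : X → X} (hf : IsEquivIsomOn H C f) : ContinuousOn f C :=
  (LipschitzOnWith.of_dist_le_mul (K := 1) fun x hx y hy => by
    simp [hf.dist_eq x hx y hy]).continuousOn

theorem IsInvariantSubspace.map_mid (hC : IsInvariantSubspace H C) {Y : Type*} [MetricSpace Y]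
    (hX : IsCAT0 X) (hY : IsCAT0 Y) {f : X → Y}
    (hf : ∀ x ∈ C, ∀ y ∈ C, dist (f x) (f y) = dist x y) {x y : X} (hx : x ∈ C) (hy : y ∈ C) :
    f (hX.mid x y) = hY.mid (f x) (f y) :=
  have hm := (hC.closedConvex hX).mid_mem _ hx _ hy
  hX.map_mid hY (hf x hx y hy) (hf x hx _ hm).le (hf y hy _ hm).le

/-- The image of a minimal subspace under an isometric embedding that is equivariant up to a
change of the acting group is minimal. -/
theorem IsMinimalSubspace.image [CompleteSpace X] {K Y : Type*} [Group K] [MetricSpace Y]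
    [MulAction K Y] (hC : IsMinimalSubspace H C) (hX : IsCAT0 X) (hY : IsCAT0 Y) {f : X → Y}
    (hf : ∀ x ∈ C, ∀ y ∈ C, dist (f x) (f y) = dist x y)
    (hHK : ∀ h : H, ∃ k : K, ∀ x ∈ C, f (h • x) = k • f x)
    (hKH : ∀ k : K, ∃ h : H, ∀ x ∈ C, f (h • x) = k • f x) :
    IsMinimalSubspace K (f '' C) := by
  have hCC := hC.1.closedConvex hX
  have hcont : ContinuousOn f C :=
    (LipschitzOnWith.of_dist_le_mul (K := 1) fun x hx y hy => by simp [hf x hx y hy]).continuousOn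
  refine ⟨IsCAT0.ClosedConvex.isInvariantSubspace (hX := hY) ⟨hCC.nonempty.image f, ?_, ?_⟩ ?_,
    ?_⟩
  · have hiso : Isometry (C.domRestrict f) := Isometry.of_dist_eq fun x y => hf x x.2 y y.2
    have : CompleteSpace C := hCC.isClosed.completeSpace_coe
    have := hiso.isClosedEmbedding.isClosed_range
    rwa [Set.range_domRestrict] at this
  · rintro _ ⟨x, hx, rfl⟩ _ ⟨y, hy, rfl⟩
    exact ⟨_, hCC.mid_mem _ hx _ hy, hC.1.map_mid hX hY hf hx hy⟩
  · rintro k _ ⟨x, hx, rfl⟩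
    obtain ⟨h, hh⟩ := hKH k
    exact ⟨h • x, hC.1.smul_mem h x hx, hh x hx⟩
  · intro D hD hDC
    have hDD := hD.closedConvex hY
    have := hC.subset_of_midConvex hX (E := C ∩ f ⁻¹' D) ?_
      (hcont.preimage_isClosed_of_isClosed hCC.isClosed hD.isClosed) ?_ ?_
    · rintro _ ⟨x, hx, rfl⟩
      exact (this hx).2
    · obtain ⟨y, hy⟩ := hD.nonempty
      obtain ⟨x, hx, rfl⟩ := hDC hy
      exact ⟨x, hx, hx, hy⟩
    · rintro a ha ⟨-, ha'⟩ b hb ⟨-, hb'⟩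
      refine ⟨hCC.mid_mem _ ha _ hb, ?_⟩
      rw [Set.mem_preimage, hC.1.map_mid hX hY hf ha hb]
      exact hDD.mid_mem _ ha' _ hb'
    · rintro h a ha ⟨-, ha'⟩
      obtain ⟨k, hk⟩ := hHK h
      refine ⟨hC.1.smul_mem h a ha, ?_⟩
      rw [Set.mem_preimage, hk a ha]
      exact hD.smul_mem k _ ha'

theorem IsMinimalSubspace.image_equivIsom [CompleteSpace X] (hC : IsMinimalSubspace H C)
    (hX : IsCAT0 X) {f : X → X} (hf : IsEquivIsomOn H C f) : IsMinimalSubspace H (f '' C) :=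
  hC.image hX hX hf.dist_eq (fun h => ⟨h, hf.map_smul h⟩) (fun h => ⟨h, hf.map_smul h⟩)

variable [IsIsometricSMul H X]

theorem IsCAT0.smul_mid (hX : IsCAT0 X) (h : H) (x y : X) :
    h • hX.mid x y = hX.mid (h • x) (h • y) :=
  hX.map_mid hX (f := (h • ·)) (dist_smul _ _ _) (dist_smul _ _ _).le (dist_smul _ _ _).le

variable [CompleteSpace X]

theorem IsInvariantSubspace.proj_smul (hC : IsInvariantSubspace H C) (hX : IsCAT0 X) (h : H)
    (x : X) : proj C (h • x) = h • proj C x := by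
  have hCC := hC.closedConvex hX
  refine (hCC.eq_proj (hC.smul_mem h _ (hCC.proj_mem x)) ?_).symm
  have : dist x (proj C x) ≤ dist x (h⁻¹ • proj C (h • x)) :=
    hCC.dist_proj_le x (hC.smul_mem _ _ (hCC.proj_mem _))
  rw [dist_smul]
  refine this.trans_eq ?_
  rw [← dist_smul h, smul_inv_smul]

theorem IsInvariantSubspace.proj_mem_subDisplacement (hC : IsInvariantSubspace H C)
    (hX : IsCAT0 X) (x : X) : proj C x ∈ subDisplacement H x := fun h => by
  rw [← hC.proj_smul hX]
  exact (hC.closedConvex hX).dist_proj_proj_le _ _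

variable (H X) in
/-- Boundedness of the subspaces that obstruct the existence and rigidity of minimal
subspaces. -/
def IsTame : Prop := ∀ x : X, Bornology.IsBounded (subDisplacement H x ∩ orbitHull H x)

/-- Zorn's lemma inside the orbit hull of `x`: the nearest points to `x` in members of a chain are
displaced no more than `x` and lie in the hull, so tameness bounds them and the chain has non-empty
intersection. -/
theorem IsTame.exists_isMinimalSubspace (hT : IsTame H X) (hX : IsCAT0 X) (x : X) :
    ∃ C : Set X, IsMinimalSubspace H C := by
  obtain ⟨R, hR⟩ := (hT x).subset_closedBall x
  set S : Set (Set X) := {C | IsInvariantSubspace H C ∧ C ⊆ orbitHull H x}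
  obtain ⟨C, -, hC⟩ := zorn_superset_nonempty S (fun c hcS hc hne => by
    have hconv : ∀ D ∈ c, hX.ClosedConvex D := fun D hD => (hcS hD).1.closedConvex hX
    have hint := IsCAT0.chain_inter_nonempty hc hne hconv x (R := R) fun D hD => by
      have := hR ⟨(hcS hD).1.proj_mem_subDisplacement hX x,
        (hcS hD).2 ((hconv D hD).proj_mem x)⟩
      rwa [Metric.mem_closedBall, dist_comm] at this
    refine ⟨⋂₀ c, ⟨IsCAT0.ClosedConvex.isInvariantSubspace (hX := hX) ⟨hint, ?_, ?_⟩ ?_, ?_⟩,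
      fun D hD => Set.sInter_subset_of_mem hD⟩
    · exact isClosed_sInter fun D hD => (hconv D hD).isClosed
    · exact fun y hy z hz D hD => (hconv D hD).mid_mem _ (hy D hD) _ (hz D hD)
    · exact fun g y hy D hD => (hcS hD).1.smul_mem g y (hy D hD)
    · obtain ⟨D, hD⟩ := hne
      exact (Set.sInter_subset_of_mem hD).trans (hcS hD).2) (orbitHull H x)
      ⟨IsInvariantSubspace.orbitHull hX x, subset_rfl⟩
  exact ⟨C, hC.1.1, fun D hD hDC => hC.2 ⟨hD, hDC.trans hC.1.2⟩ hDC⟩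

end Invariant

/-! ### Parallelism of two minimal subspaces. -/

section Parallel

variable {H X : Type*} [Group H] [MetricSpace X] [MulAction H X] [IsIsometricSMul H X]
  [CompleteSpace X] {C C' C'' : Set X} (hC : IsMinimalSubspace H C)
  (hC' : IsMinimalSubspace H C') (hX : IsCAT0 X)
include hC hC' hX

theorem IsMinimalSubspace.dist_proj_eq {x y : X} (hx : x ∈ C) (hy : y ∈ C) :
    dist x (proj C' x) = dist y (proj C' y) := by
  have hCC' := hC'.1.closedConvex hX
  refine hC.eq_of_convex hX (f := fun z => dist z (proj C' z))
    (continuous_id.dist hCC'.continuous_proj).continuousOn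
    (fun _ _ _ _ => hCC'.dist_mid_proj_le _ _) (fun h z _ => ?_) hx hy
  rw [hC'.1.proj_smul hX, dist_smul]

theorem IsMinimalSubspace.proj_proj {x : X} (hx : x ∈ C) : proj C (proj C' x) = x := by
  have hCC := hC.1.closedConvex hX
  have hCC' := hC'.1.closedConvex hX
  refine (hCC.eq_proj hx ?_).symm
  have h₁ := hC.dist_proj_eq hC' hX hx (hCC.proj_mem (proj C' x))
  have h₂ := hCC'.dist_proj_le (proj C (proj C' x)) (hCC'.proj_mem x)
  rw [dist_comm _ (proj C' x)] at h₂
  rw [dist_comm, h₁]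
  exact h₂

theorem IsMinimalSubspace.isEquivIsomOn_proj : IsEquivIsomOn H C (proj C') where
  dist_eq x hx y hy := by
    refine le_antisymm ((hC'.1.closedConvex hX).dist_proj_proj_le x y) ?_
    have := (hC.1.closedConvex hX).dist_proj_proj_le (proj C' x) (proj C' y)
    rwa [hC.proj_proj hC' hX hx, hC.proj_proj hC' hX hy] at this
  map_smul h x _ := hC'.1.proj_smul hX h x

/-- One inequality is the projection property. In the quadrilateral `x`, `proj C' x`, `y`, `proj C
y` opposite sides are equal, and the quadrilateral inequality, with the projection property on the
other diagonal, gives the converse. -/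
theorem IsMinimalSubspace.dist_sq_eq {x y : X} (hx : x ∈ C) (hy : y ∈ C') :
    dist x y ^ 2 = dist (proj C' x) y ^ 2 + dist x (proj C' x) ^ 2 := by
  have hCC := hC.1.closedConvex hX
  have hCC' := hC'.1.closedConvex hX
  have h₁ := hCC'.dist_proj_sq_add_le x hy
  have h₂ := hCC'.dist_proj_sq_add_le (proj C y) (hCC'.proj_mem x)
  have h₃ := hX.quadrilateral x (proj C' x) y (proj C y)
  have h₄ := (hC'.isEquivIsomOn_proj hC hX).dist_eq _ (hCC'.proj_mem x) _ hy
  have h₅ := hC.dist_proj_eq hC' hX hx (hCC.proj_mem y)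
  rw [hC'.proj_proj hC hX hy] at h₂ h₅
  rw [hC.proj_proj hC' hX hx] at h₄
  rw [dist_comm y (proj C' x), dist_comm (proj C y) (proj C' x)] at h₂
  rw [dist_comm y (proj C y), dist_comm (proj C y) x, h₄, ← h₅] at h₃
  rw [← h₅] at h₂
  linarith

/-- The midpoints between `C` and a second minimal subspace form a parallel copy of `C`. -/
theorem IsMinimalSubspace.isEquivIsomOn_mid_proj :
    IsEquivIsomOn H C (fun x => hX.mid x (proj C' x)) ∧
      ∀ x ∈ C, proj C (hX.mid x (proj C' x)) = x := by
  have hCC := hC.1.closedConvex hX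
  have hCC' := hC'.1.closedConvex hX
  have hpr : ∀ x ∈ C, proj C (hX.mid x (proj C' x)) = x := by
    intro x hx
    refine (hCC.eq_proj hx ?_).symm
    set m := hX.mid x (proj C' x) with hm
    -- A point of `C` closer to `m` than `x` would also be closer to `proj C' x`, whose nearest
    -- point in `C` is `x`.
    have h₁ : dist (proj C' x) x ≤ dist (proj C' x) (proj C m) := by
      have := hCC.dist_proj_le (proj C' x) (hCC.proj_mem m)
      rwa [hC.proj_proj hC' hX hx] at this
    have h₂ := dist_triangle (proj C' x) m (proj C m)
    have h₃ := hX.dist_left_mid x (proj C' x)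
    have h₄ := hX.dist_right_mid x (proj C' x)
    rw [← hm] at h₃ h₄
    rw [dist_comm m x]
    rw [dist_comm _ x] at h₁
    linarith
  refine ⟨⟨fun x hx y hy => le_antisymm ?_ ?_, fun h x _ => ?_⟩, hpr⟩
  · have h₁ := hX.dist_mid_mid_le x (proj C' x) y (proj C' y)
    rw [(hC.isEquivIsomOn_proj hC' hX).dist_eq x hx y hy] at h₁
    linarith
  · have := hCC.dist_proj_proj_le (hX.mid x (proj C' x)) (hX.mid y (proj C' y))
    rwa [hpr x hx, hpr y hy] at this
  · rw [hC'.1.proj_smul hX, hX.smul_mid]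

/-- In a flat strip the midpoint of a diagonal lies on the middle line. Take `q` halfway from `x` to
the foot of `y` and go halfway across; three applications of Pythagoras show that this point has the
distances of a midpoint. -/
theorem IsMinimalSubspace.exists_mid_mem {x y : X} (hx : x ∈ C) (hy : y ∈ C') :
    ∃ D, IsMinimalSubspace H D ∧ hX.mid x y ∈ D := by
  have hCC := hC.1.closedConvex hX
  have hCC' := hC'.1.closedConvex hX
  obtain ⟨hμ, hpμ⟩ := hC.isEquivIsomOn_mid_proj hC' hX
  refine ⟨_, hC.image_equivIsom hX hμ, hX.mid x (proj C y), hCC.mid_mem _ hx _ (hCC.proj_mem y),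
    ?_⟩
  set D := (fun x => hX.mid x (proj C' x)) '' C with hD
  have hDmin : IsMinimalSubspace H D := hC.image_equivIsom hX hμ
  have hDD := hDmin.1.closedConvex hX
  set q := hX.mid x (proj C y)
  have hq : q ∈ C := hCC.mid_mem _ hx _ (hCC.proj_mem y)
  have hmD : hX.mid q (proj C' q) ∈ D := ⟨q, hq, rfl⟩
  have hpyC := hCC.proj_mem y
  have pyth : dist y x ^ 2 = dist (proj C y) x ^ 2 + dist y (proj C y) ^ 2 :=
    hC'.dist_sq_eq hC hX hy hx
  have hpm := hpμ q hq
  have e₁ : dist (hX.mid q (proj C' q)) x ^ 2 = dist q x ^ 2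
      + dist (hX.mid q (proj C' q)) q ^ 2 := by
    have := hDmin.dist_sq_eq hC hX hmD hx
    rwa [hpm] at this
  have ea : dist q (proj C' q) = dist y (proj C y) := by
    have := hC.dist_proj_eq hC' hX hq hpyC
    rw [hC'.proj_proj hC hX hy] at this
    rw [this, dist_comm]
  have hqC' : proj C' (hX.mid q (proj C' q)) = proj C' q := by
    have h := (hC'.isEquivIsomOn_mid_proj hC hX).2 (proj C' q) (hCC'.proj_mem q)
    rwa [hC.proj_proj hC' hX hq, hX.mid_comm] at h
  have e₂ : dist (hX.mid q (proj C' q)) y ^ 2 = dist (proj C' q) y ^ 2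
      + dist (hX.mid q (proj C' q)) (proj C' q) ^ 2 := by
    have := hDmin.dist_sq_eq hC' hX hmD hy
    rwa [hqC'] at this
  have e₃ : dist (proj C' q) y = dist q (proj C y) := by
    have := (hC.isEquivIsomOn_proj hC' hX).dist_eq q hq _ hpyC
    rwa [hC'.proj_proj hC hX hy] at this
  have f₁ := hX.dist_left_mid q (proj C' q)
  have f₂ := hX.dist_right_mid q (proj C' q)
  have f₃ := hX.dist_left_mid x (proj C y)
  have f₄ := hX.dist_right_mid x (proj C y)
  rw [dist_comm q x, dist_comm (hX.mid q (proj C' q)) q, f₁, f₃, ea] at e₁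
  rw [e₃, dist_comm q (proj C y), dist_comm (hX.mid q (proj C' q)) (proj C' q), f₂, f₄, ea] at e₂
  rw [dist_comm y x, dist_comm (proj C y) x] at pyth
  apply hX.eq_mid
  · refine le_of_sq_le_sq ?_ (by positivity)
    rw [dist_comm]
    nlinarith
  · refine le_of_sq_le_sq ?_ (by positivity)
    rw [dist_comm]
    nlinarith

end Parallel

/-! ### Rigidity in the tame case and the union of minimal subspaces. -/

section Rigidity

variable {H X : Type*} [Group H] [MetricSpace X] [MulAction H X] [IsIsometricSMul H X]
  [CompleteSpace X] {C C' C'' : Set X} (hT : IsTame H X) (hX : IsCAT0 X)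
  (hC : IsMinimalSubspace H C)
include hT hX hC

omit [CompleteSpace X] hT in
theorem IsMinimalSubspace.displacement_eq {f : X → X} (hf : IsEquivIsomOn H C f)
    {x y : X} (hx : x ∈ C) (hy : y ∈ C) : dist x (f x) = dist y (f y) := by
  refine hC.eq_of_convex hX (f := fun z => dist z (f z))
    (continuous_dist.comp_continuousOn (continuousOn_id.prodMk hf.continuousOn))
    (fun a ha b hb => ?_) (fun h z hz => ?_) hx hy
  · rw [hC.1.map_mid hX hX hf.dist_eq ha hb]
    exact hX.dist_mid_mid_le _ _ _ _
  · simp only [hf.map_smul h z hz, dist_smul]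

omit [CompleteSpace X] in
/-- In the tame case an equivariant isometric self-embedding of a minimal subspace is the
identity. -/
theorem IsTame.eq_self_of_isEquivIsomOn {f : X → X} (hf : IsEquivIsomOn H C f)
    (hm : Set.MapsTo f C C) {x : X} (hx : x ∈ C) : f x = x := by
  have hCC := hC.1.closedConvex hX
  have key : ∀ k : ℕ, ∃ g : X → X, IsEquivIsomOn H C g ∧ Set.MapsTo g C C ∧
      2 ^ k * dist x (f x) ≤ dist x (g x) := by
    intro k
    induction k with
    | zero => exact ⟨f, hf, hm, by simp⟩
    | succ k ih =>
      obtain ⟨g, hg, hgm, hk⟩ := ih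
      refine ⟨g ∘ g, hg.comp hg hgm, hgm.comp hgm, ?_⟩
      -- The displacement of `g` is the same at `x` and at the midpoint of `x` and `g x`; comparing
      -- midpoints shows that `g ∘ g` moves `x` at least twice as far.
      have h₁ := hC.displacement_eq hX hg hx (hCC.mid_mem _ hx _ (hgm hx))
      rw [hC.1.map_mid hX hX hg.dist_eq hx (hgm hx), hX.mid_comm x] at h₁
      have h₂ := hX.dist_mid_mid_left_le (g x) x (g (g x))
      simp only [Function.comp]
      rw [pow_succ]
      linarith
  obtain ⟨R, hR⟩ := (hT x).subset_closedBall x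
  by_contra hne
  have hpos : 0 < dist x (f x) := dist_pos.2 (Ne.symm hne)
  obtain ⟨k, hk⟩ := pow_unbounded_of_one_lt (R / dist x (f x)) (one_lt_two (α := ℝ))
  obtain ⟨g, hg, hgm, hgk⟩ := key k
  have hmem : g x ∈ subDisplacement H x ∩ orbitHull H x := by
    refine ⟨fun h => ?_, ?_⟩
    · rw [← hg.map_smul h x hx, hg.dist_eq _ (hC.1.smul_mem h x hx) _ hx]
    · rw [← hC.eq_orbitHull hX hx]
      exact hgm hx
  have := hR hmem
  rw [Metric.mem_closedBall, dist_comm] at this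
  rw [div_lt_iff₀ hpos] at hk
  linarith

variable (hC' : IsMinimalSubspace H C')
include hC'

theorem IsTame.eq_proj_of_isEquivIsomOn {f : X → X} (hf : IsEquivIsomOn H C f)
    (hm : Set.MapsTo f C C') {x : X} (hx : x ∈ C) : f x = proj C' x := by
  have h := hT.eq_self_of_isEquivIsomOn hX hC ((hC'.isEquivIsomOn_proj hC hX).comp hf hm)
    (fun _ _ => (hC.1.closedConvex hX).proj_mem _) hx
  rw [← hC'.proj_proj hC hX (hm hx)]
  exact congrArg _ h

/-- Rigidity leaves room for only one equivariant isometric embedding between two minimal subspaces,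
so there is no holonomy. -/
theorem IsTame.proj_proj (hC'' : IsMinimalSubspace H C'') {x : X} (hx : x ∈ C) :
    proj C'' (proj C' x) = proj C'' x :=
  hT.eq_proj_of_isEquivIsomOn hX hC hC'' ((hC'.isEquivIsomOn_proj hC'' hX).comp
    (hC.isEquivIsomOn_proj hC' hX) fun _ _ => (hC'.1.closedConvex hX).proj_mem _)
    (fun _ _ => (hC''.1.closedConvex hX).proj_mem _) hx

omit hC hC'

/-- The union of the minimal subspaces. -/
def minimalUnion (H X : Type*) [Group H] [MetricSpace X] [MulAction H X] : Set X :=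
  ⋃₀ {C | IsMinimalSubspace H C}

/-- The projections of one fixed leaf to the leaves through `x k` converge pointwise, because
without holonomy they are as close as the leaves are. The limit is an equivariant isometric
embedding whose image is a minimal subspace through `a`. -/
theorem IsTame.isClosed_minimalUnion : IsClosed (minimalUnion H X) := by
  rw [← isSeqClosed_iff_isClosed]
  intro x a hx ha
  choose D hD hxD using hx
  have hD : ∀ k, IsMinimalSubspace H (D k) := hD
  have hCC := (hD 0).1.closedConvex hX
  have hdist : ∀ z ∈ D 0, ∀ k l, dist (proj (D k) z) (proj (D l) z) ≤ dist (x k) (x l) := by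
    intro z hz k l
    have hk := ((hD k).1.closedConvex hX).proj_mem z
    rw [← hT.proj_proj hX (hD 0) (hD k) (hD l) hz,
      (hD k).dist_proj_eq (hD l) hX hk (hxD k)]
    exact ((hD l).1.closedConvex hX).dist_proj_le _ (hxD l)
  have hcau : ∀ z ∈ D 0, ∃ w, Filter.Tendsto (fun k => proj (D k) z) Filter.atTop (nhds w) := by
    intro z hz
    apply cauchySeq_tendsto_of_complete
    rw [Metric.cauchySeq_iff]
    intro ε hε
    obtain ⟨N, hN⟩ := Metric.cauchySeq_iff.1 ha.cauchySeq ε hε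
    exact ⟨N, fun k hk l hl => (hdist z hz k l).trans_lt (hN k hk l hl)⟩
  choose! f hf using hcau
  have hfe : IsEquivIsomOn H (D 0) f := by
    refine ⟨fun y hy z hz => ?_, fun h z hz => ?_⟩
    · refine tendsto_nhds_unique ((hf y hy).dist (hf z hz)) ?_
      simp only [((hD 0).isEquivIsomOn_proj (hD _) hX).dist_eq y hy z hz]
      exact tendsto_const_nhds
    · refine tendsto_nhds_unique (hf _ ((hD 0).1.smul_mem h z hz)) ?_
      simp only [(hD _).1.proj_smul hX]
      exact ((isometry_smul X h).continuous.tendsto _).comp (hf z hz)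
  refine ⟨_, (hD 0).image_equivIsom hX hfe, proj (D 0) a, hCC.proj_mem a, ?_⟩
  refine tendsto_nhds_unique (hf _ (hCC.proj_mem a)) ?_
  refine tendsto_iff_dist_tendsto_zero.2 ?_
  have hb : ∀ k, dist (proj (D k) (proj (D 0) a)) a ≤ 2 * dist (x k) a := by
    intro k
    have h₁ := ((hD k).1.closedConvex hX).dist_proj_proj_le (proj (D 0) a) (proj (D 0) (x k))
    rw [(hD k).proj_proj (hD 0) hX (hxD k)] at h₁
    have h₂ := hCC.dist_proj_proj_le a (x k)
    rw [dist_comm a] at h₂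
    linarith [dist_triangle (proj (D k) (proj (D 0) a)) (x k) a]
  refine squeeze_zero (fun _ => dist_nonneg) hb ?_
  simpa using (tendsto_iff_dist_tendsto_zero.1 ha).const_mul 2

omit hT in
theorem mid_mem_minimalUnion : hX.MidConvex (minimalUnion H X) := by
  rintro x ⟨C, hC, hx⟩ y ⟨C', hC', hy⟩
  exact IsMinimalSubspace.exists_mid_mem hC hC' hX hx hy

end Rigidity

/-! ### The central component and its invariance. -/

section Central

variable {H X : Type*} [Group H] [MetricSpace X] [MulAction H X]

theorem setDist_image {Y : Type*} [MetricSpace Y] {f : X → Y} (hf : Isometry f) (A B : Set X) :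
    setDist (f '' A) (f '' B) = setDist A B := by
  unfold setDist
  congr 1
  ext r
  constructor
  · rintro ⟨_, ⟨x, hx, rfl⟩, _, ⟨y, hy, rfl⟩, rfl⟩
    exact ⟨x, hx, y, hy, hf.dist_eq x y⟩
  · rintro ⟨x, hx, y, hy, rfl⟩
    exact ⟨_, ⟨x, hx, rfl⟩, _, ⟨y, hy, rfl⟩, (hf.dist_eq x y).symm⟩

variable [CompleteSpace X]

theorem IsMinimalSubspace.image_isometryEquiv {C : Set X} (hC : IsMinimalSubspace H C)
    (hX : IsCAT0 X) (φ : X ≃ᵢ X) (ψ : H ≃* H) (h : ∀ (g : H) (x : X), φ (g • x) = ψ g • φ x) :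
    IsMinimalSubspace H (φ '' C) :=
  hC.image hX hX (fun x _ y _ => φ.isometry.dist_eq x y) (fun g => ⟨ψ g, fun x _ => h g x⟩)
    fun g => ⟨ψ.symm g, fun x _ => by rw [h, ψ.apply_symm_apply]⟩

theorem IsCentralComponent.image_isometryEquiv {Z : Set X} (hZ : IsCentralComponent H Z)
    (hX : IsCAT0 X) (φ : X ≃ᵢ X) (ψ : H ≃* H) (h : ∀ (g : H) (x : X), φ (g • x) = ψ g • φ x) :
    IsCentralComponent H (φ '' Z) := by
  have h' : ∀ (g : H) (x : X), φ.symm (g • x) = ψ.symm g • φ.symm x := fun g x => by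
    rw [IsometryEquiv.symm_apply_eq, h, ψ.apply_symm_apply, φ.apply_symm_apply]
  have e : ∀ C : Set X, φ '' (φ.symm '' C) = C := fun C => by
    rw [Set.image_image]
    simp
  obtain ⟨hmin, ρ, hρ, hleast⟩ := hZ
  refine ⟨hmin.image_isometryEquiv hX φ ψ h, ρ, fun C hC => ?_, fun C r hC hr => ?_⟩
  · rw [← e C, setDist_image φ.isometry]
    exact hρ _ (hC.image_isometryEquiv hX φ.symm ψ.symm h')
  · refine hleast _ r (hC.image_isometryEquiv hX φ.symm ψ.symm h') fun C' hC' => ?_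
    rw [← setDist_image φ.isometry, e]
    exact hr _ (hC'.image_isometryEquiv hX φ ψ h)

variable [IsIsometricSMul H X]

theorem IsMinimalSubspace.setDist_eq {C C' : Set X} (hC : IsMinimalSubspace H C)
    (hC' : IsMinimalSubspace H C') (hX : IsCAT0 X) {x : X} (hx : x ∈ C) :
    setDist C C' = dist x (proj C' x) := by
  have hCC' := hC'.1.closedConvex hX
  refine IsLeast.csInf_eq ⟨⟨x, hx, _, hCC'.proj_mem x, rfl⟩, ?_⟩
  rintro _ ⟨y, hy, z, hz, rfl⟩
  rw [hC.dist_proj_eq hC' hX hx hy]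
  exact hCC'.dist_proj_le y hz

/-- If the sets `subDisplacement H x` are bounded, the space of components has a unique
circumcentre. -/
theorem exists_unique_isCentralComponent [Nonempty X] (hX : IsCAT0 X)
    (hb : ∀ x : X, Bornology.IsBounded (subDisplacement H x)) :
    ∃ Z : Set X, IsCentralComponent H Z ∧ ∀ Z', IsCentralComponent H Z' → Z' = Z := by
  have hT : IsTame H X := fun x => (hb x).subset Set.inter_subset_left
  obtain ⟨C₀, hC₀⟩ := hT.exists_isMinimalSubspace hX (Classical.arbitrary X)
  have hCC₀ := hC₀.1.closedConvex hX
  obtain ⟨z₀, hz₀⟩ := hC₀.1.nonempty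
  -- `F` is a transversal meeting each component in exactly one point, the projection of `z₀`;
  -- distances in `F` are the distances between components.
  set F : Set X := minimalUnion H X ∩ proj C₀ ⁻¹' {z₀} with hF
  have memF : ∀ C, IsMinimalSubspace H C → proj C z₀ ∈ F := fun C hC =>
    ⟨⟨C, hC, (hC.1.closedConvex hX).proj_mem z₀⟩, hC₀.proj_proj hC hX hz₀⟩
  have eqF : ∀ C, IsMinimalSubspace H C → ∀ x ∈ F, x ∈ C → x = proj C z₀ := fun C hC x hx hxC => by
    rw [← (show proj C₀ x = z₀ from hx.2), hC.proj_proj hC₀ hX hxC]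
  have hconv : hX.ClosedConvex F := by
    refine ⟨⟨_, memF C₀ hC₀⟩, (hT.isClosed_minimalUnion hX).inter
      (isClosed_singleton.preimage hCC₀.continuous_proj), ?_⟩
    intro x hx y hy
    refine ⟨mid_mem_minimalUnion hX x hx.1 y hy.1, ?_⟩
    obtain ⟨C, hC, hxC⟩ := hx.1
    obtain ⟨C', hC', hyC'⟩ := hy.1
    have hC : IsMinimalSubspace H C := hC
    have hC' : IsMinimalSubspace H C' := hC'
    have hyx : y = proj C' x := by
      rw [eqF C hC x hx hxC, hT.proj_proj hX hC₀ hC hC' hz₀]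
      exact eqF C' hC' y hy hyC'
    obtain ⟨hμ, -⟩ := hC.isEquivIsomOn_mid_proj hC' hX
    have hm := Set.mapsTo_image (fun x => hX.mid x (proj C' x)) C
    -- Passing to the middle leaf and projecting to `C₀` is an equivariant isometric embedding of
    -- `C`, hence agrees with direct projection: midpoints stay over `z₀`.
    have := hT.eq_proj_of_isEquivIsomOn hX hC hC₀
      (((hC.image_equivIsom hX hμ).isEquivIsomOn_proj hC₀ hX).comp hμ hm)
      (fun _ _ => hCC₀.proj_mem _) hxC
    rw [hyx]
    exact this.trans hx.2
  have hFb : Bornology.IsBounded F := by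
    refine (hb z₀).subset fun x hx => ?_
    obtain ⟨C, hC, hxC⟩ := hx.1
    rw [eqF C hC x hx hxC]
    exact hC.1.proj_mem_subDisplacement hX z₀
  have hdist : ∀ C, IsMinimalSubspace H C → ∀ C', IsMinimalSubspace H C' →
      setDist C C' = dist (proj C z₀) (proj C' z₀) := by
    intro C hC C' hC'
    rw [hC.setDist_eq hC' hX ((hC.1.closedConvex hX).proj_mem z₀),
      hT.proj_proj hX hC₀ hC hC' hz₀]
  obtain ⟨z, hz, ρ, hzρ, hρ, huniq⟩ := hconv.exists_circumcentre hFb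
  have radius : ∀ C, IsMinimalSubspace H C → ∀ r,
      (∀ C', IsMinimalSubspace H C' → setDist C C' ≤ r) → ∀ y ∈ F, dist (proj C z₀) y ≤ r := by
    intro C hC r hr y hy
    obtain ⟨C', hC', hyC'⟩ := hy.1
    rw [eqF C' hC' y hy hyC', ← hdist C hC C' hC']
    exact hr C' hC'
  obtain ⟨Z, hZ, hzZ⟩ := hz.1
  have hZ : IsMinimalSubspace H Z := hZ
  have hZρ : ∀ C, IsMinimalSubspace H C → setDist Z C ≤ ρ := fun C hC => by
    rw [hdist Z hZ C hC, ← eqF Z hZ z hz hzZ]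
    exact hzρ _ (memF C hC)
  refine ⟨Z, ⟨hZ, ρ, hZρ, fun C r hC hr => hρ _ (memF C hC) r (radius C hC r hr)⟩, ?_⟩
  rintro Z' ⟨hZ', ρ', hZ'ρ, hρ'⟩
  have hle : ρ' ≤ ρ := hρ' Z ρ hZ hZρ
  have hz' : proj Z' z₀ = z := huniq _ (memF Z' hZ') fun y hy =>
    (radius Z' hZ' ρ' hZ'ρ y hy).trans hle
  have hzZ' : z ∈ Z' := hz' ▸ (hZ'.1.closedConvex hX).proj_mem z₀
  rw [hZ'.eq_orbitHull hX hzZ', hZ.eq_orbitHull hX hzZ]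

end Central

/-! ### Boundedness from non-evanescence. -/

section Evanescent

variable {G X : Type*} [Group G] [TopologicalSpace G] [MetricSpace X] [MulAction G X]

theorem isBounded_of_not_isEvanescent (hG : ¬ IsEvanescent G X) {T : Set X} {b : G → ℝ}
    (hb : Continuous b) (h : ∀ g, ∀ t ∈ T, dist (g • t) t ≤ b g) : Bornology.IsBounded T := by
  by_contra hT
  refine hG ⟨T, hT, fun Q hQ => ?_⟩
  obtain ⟨M, hM⟩ := hQ.bddAbove_image hb.continuousOn
  refine (Metric.isBounded_Icc 0 M).subset ?_
  rintro _ ⟨g, hg, x, hx, rfl⟩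
  exact ⟨dist_nonneg, (h g x hx).trans (hM ⟨g, hg, rfl⟩)⟩

theorem isBounded_subDisplacement [ContinuousSMul G X] (hG : ¬ IsEvanescent G X) (x : X) :
    Bornology.IsBounded (subDisplacement G x) :=
  isBounded_of_not_isEvanescent hG (b := fun g => dist (g • x) x) (by fun_prop)
    fun g _ ht => ht g

end Evanescent

/-! ### Restriction of the structure to an invariant subspace. -/

section Subtype

variable {H X : Type*} [Group H] [MetricSpace X] [MulAction H X] {C : Set X}

theorem IsGeodConvex.isCAT0 (hC : IsGeodConvex C) (hX : IsCAT0 X) : IsCAT0 C := by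
  classical
  refine ⟨fun x y => ?_, fun x c c' γ h => ?_⟩
  · obtain ⟨γ, h⟩ := hX.exists_geodesic (x : X) y
    have hmem : ∀ t ∈ Set.Icc 0 (dist x y), γ t ∈ C := hC x x.2 y y.2 γ h
    have d0 : 0 ≤ dist x y := dist_nonneg
    set γ' : ℝ → C := fun t => if h : γ t ∈ C then ⟨γ t, h⟩ else x
    have hγ' : ∀ t ∈ Set.Icc 0 (dist x y), (γ' t : X) = γ t := fun t ht => by
      simp only [γ', dif_pos (hmem t ht)]
    refine ⟨γ', Subtype.ext ?_, Subtype.ext ?_, fun s hs t ht => ?_⟩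
    · rw [hγ' 0 ⟨le_rfl, d0⟩, h.source]
    · rw [hγ' _ ⟨d0, le_rfl⟩]
      exact h.target
    · rw [Subtype.dist_eq, hγ' s hs, hγ' t ht]
      exact h.isometry s hs t ht
  · refine hX.bruhat_tits (x : X) c c' (fun t => γ t) ⟨?_, ?_, fun s hs t ht => ?_⟩
    · rw [h.source]
    · exact congrArg _ h.target
    · exact h.isometry s hs t ht

/-- The action on an invariant subspace. -/
abbrev IsInvariantSubspace.mulAction (hC : IsInvariantSubspace H C) : MulAction H C where
  smul h x := ⟨h • (x : X), hC.smul_mem h x x.2⟩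
  one_smul x := Subtype.ext (one_smul H (x : X))
  mul_smul g h x := Subtype.ext (mul_smul g h (x : X))

theorem IsInvariantSubspace.isIsometricSMul [IsIsometricSMul H X] (hC : IsInvariantSubspace H C) :
    letI := hC.mulAction
    IsIsometricSMul H C :=
  letI := hC.mulAction
  ⟨fun h => Isometry.of_dist_eq fun x y => dist_smul h (x : X) y⟩

theorem IsInvariantSubspace.continuousSMul [TopologicalSpace H] [ContinuousSMul H X]
    (hC : IsInvariantSubspace H C) :
    letI := hC.mulAction
    ContinuousSMul H C :=
  letI := hC.mulAction
  ⟨Continuous.subtype_mk (continuous_fst.smul (continuous_subtype_val.comp continuous_snd)) _⟩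

theorem IsMinimalSubspace.isMinimalSubspace_univ (hC : IsMinimalSubspace H C) (hX : IsCAT0 X) :
    letI := hC.1.mulAction
    IsMinimalSubspace H (Set.univ : Set C) := by
  let := hC.1.mulAction
  have hCX : IsCAT0 C := hC.1.convex.isCAT0 hX
  refine ⟨IsCAT0.ClosedConvex.isInvariantSubspace (hX := hCX)
    ⟨hC.1.nonempty.to_subtype.elim fun x => ⟨x, trivial⟩, isClosed_univ, fun _ _ _ _ => trivial⟩
    fun _ _ _ => trivial, fun D hD _ x _ => ?_⟩
  have hDX : IsInvariantSubspace H ((↑) '' D : Set X) := by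
    refine IsCAT0.ClosedConvex.isInvariantSubspace (hX := hX) ⟨hD.nonempty.image _, ?_, ?_⟩ ?_
    · exact hC.1.isClosed.isClosedEmbedding_subtypeVal.isClosedMap _ hD.isClosed
    · rintro _ ⟨x, hx, rfl⟩ _ ⟨y, hy, rfl⟩
      exact ⟨_, (hD.closedConvex hCX).mid_mem _ hx _ hy,
        hD.map_mid hCX hX (fun _ _ _ _ => rfl) hx hy⟩
    · rintro h _ ⟨x, hx, rfl⟩
      exact ⟨h • x, hD.smul_mem h x hx, rfl⟩
  obtain ⟨y, hy, hyx⟩ := hC.2 hDX (by rintro _ ⟨y, -, rfl⟩; exact y.2) x.2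
  rwa [← Subtype.ext hyx]

theorem IsEvanescent.of_subtype [TopologicalSpace H] (hC : IsInvariantSubspace H C)
    (h : letI := hC.mulAction
      IsEvanescent H C) : IsEvanescent H X := by
  let := hC.mulAction
  obtain ⟨T, hT, hQ⟩ := h
  refine ⟨(↑) '' T, fun hb => hT ?_, fun Q hQc => (hQ Q hQc).subset ?_⟩
  · obtain ⟨M, hM⟩ := Metric.isBounded_iff.1 hb
    exact Metric.isBounded_iff.2 ⟨M, fun x hx y hy => hM ⟨x, hx, rfl⟩ ⟨y, hy, rfl⟩⟩
  · rintro _ ⟨g, hg, _, ⟨x, hx, rfl⟩, rfl⟩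
    exact ⟨g, hg, x, hx, rfl⟩

end Subtype

/-! ### Coordinates for a foliation by minimal subspaces. -/

section Foliation

variable {H X : Type*} [Group H] [MetricSpace X] [MulAction H X] [IsIsometricSMul H X]
  [CompleteSpace X]

variable (H) in
/-- The point of the leaf `orbitHull H z` corresponding to `y`. -/
noncomputable def setCoord (y z : X) : X := proj (orbitHull H z) y

variable (H) in
/-- The coordinate of `z` along the leaf of `z₀`. -/
noncomputable def coord (z₀ z : X) : X := proj (orbitHull H z₀) z

variable (hT : IsTame H X) (hX : IsCAT0 X)
  (hK : ∀ z : X, IsMinimalSubspace H (orbitHull H z))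

include hX hK

omit [IsIsometricSMul H X] in
theorem coord_mem (z₀ z : X) : coord H z₀ z ∈ orbitHull H z₀ :=
  ((hK z₀).1.closedConvex hX).proj_mem z

omit [IsIsometricSMul H X] in
theorem setCoord_mem (y z : X) : setCoord H y z ∈ orbitHull H z :=
  ((hK z).1.closedConvex hX).proj_mem y

omit [IsIsometricSMul H X] [CompleteSpace X] in
theorem orbitHull_eq_of_mem {z w : X} (h : w ∈ orbitHull H z) : orbitHull H w = orbitHull H z :=
  ((hK z).eq_orbitHull hX h).symm

theorem coord_setCoord {z₀ y : X} (hy : y ∈ orbitHull H z₀) (z : X) :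
    coord H z₀ (setCoord H y z) = y :=
  (hK z₀).proj_proj (hK z) hX hy

omit [IsIsometricSMul H X] in
theorem continuous_coord (z₀ : X) : Continuous (coord H z₀) :=
  ((hK z₀).1.closedConvex hX).continuous_proj

include hT

theorem dist_sq_eq_coord_add (z₀ z w : X) :
    dist z w ^ 2 = dist (coord H z₀ z) (coord H z₀ w) ^ 2 +
      dist (setCoord H z₀ z) (setCoord H z₀ w) ^ 2 := by
  have hz := mem_orbitHull (H := H) z
  have hw := mem_orbitHull (H := H) w
  have hz₀ := mem_orbitHull (H := H) z₀
  have hp : proj (orbitHull H w) z ∈ orbitHull H w := ((hK w).1.closedConvex hX).proj_mem z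
  rw [(hK z).dist_sq_eq (hK w) hX hz hw, (hK z).dist_proj_eq (hK w) hX hz (setCoord_mem hX hK z₀ z),
    ← ((hK w).isEquivIsomOn_proj (hK z₀) hX).dist_eq _ hp w hw,
    hT.proj_proj hX (hK z) (hK w) (hK z₀) hz]
  congr 3
  exact hT.proj_proj hX (hK z₀) (hK z) (hK w) hz₀

theorem coord_mid_and_setCoord_mid (z₀ x y : X) :
    coord H z₀ (hX.mid x y) = hX.mid (coord H z₀ x) (coord H z₀ y) ∧
      setCoord H z₀ (hX.mid x y) = hX.mid (setCoord H z₀ x) (setCoord H z₀ y) := by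
  set m := hX.mid x y with hm
  have e := dist_sq_eq_coord_add hT hX hK z₀ x y
  have e₁ := dist_sq_eq_coord_add hT hX hK z₀ x m
  have e₂ := dist_sq_eq_coord_add hT hX hK z₀ y m
  rw [hm, hX.dist_left_mid, ← hm] at e₁
  rw [hm, hX.dist_right_mid, ← hm] at e₂
  have t₁ := dist_triangle_right (coord H z₀ x) (coord H z₀ y) (coord H z₀ m)
  have t₂ := dist_triangle_right (setCoord H z₀ x) (setCoord H z₀ y) (setCoord H z₀ m)
  -- Equality case of the triangle inequality in the Euclidean plane: the parallelogram law forces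
  -- `u = u'` and `v = v'`.
  have key : ∀ {U V u v u' v' d : ℝ}, 0 ≤ U → 0 ≤ V → 0 ≤ u → 0 ≤ v → 0 ≤ u' → 0 ≤ v' →
      d ^ 2 = U ^ 2 + V ^ 2 → (d / 2) ^ 2 = u ^ 2 + v ^ 2 → (d / 2) ^ 2 = u' ^ 2 + v' ^ 2 →
      U ≤ u + u' → V ≤ v + v' → (u ≤ U / 2 ∧ u' ≤ U / 2) ∧ v ≤ V / 2 ∧ v' ≤ V / 2 := by
    intro U V u v u' v' d hU hV hu hv hu' hv' e e₁ e₂ t₁ t₂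
    have s₁ := pow_le_pow_left₀ hU t₁ 2
    have s₂ := pow_le_pow_left₀ hV t₂ 2
    have q : (u - u') ^ 2 + (v - v') ^ 2 ≤ 0 := by nlinarith
    have hu'' : u = u' := by
      have : (u - u') ^ 2 = 0 := le_antisymm (by linarith [sq_nonneg (v - v')]) (sq_nonneg _)
      linarith [pow_eq_zero_iff two_ne_zero |>.1 this]
    have hv'' : v = v' := by
      have : (v - v') ^ 2 = 0 := le_antisymm (by linarith [sq_nonneg (u - u')]) (sq_nonneg _)
      linarith [pow_eq_zero_iff two_ne_zero |>.1 this]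
    subst hu'' hv''
    have a : u ≤ U / 2 := le_of_sq_le_sq (by nlinarith) (by positivity)
    have b : v ≤ V / 2 := le_of_sq_le_sq (by nlinarith) (by positivity)
    exact ⟨⟨a, a⟩, b, b⟩
  obtain ⟨⟨a, a'⟩, b, b'⟩ := key dist_nonneg dist_nonneg dist_nonneg dist_nonneg dist_nonneg
    dist_nonneg e e₁ e₂ t₁ t₂
  exact ⟨hX.eq_mid a a', hX.eq_mid b b'⟩

end Foliation

/-! ### The factors of a product group acting on a minimal space. -/

section Product

variable {ι : Type*} [DecidableEq ι] {G : ι → Type*} [∀ i, Group (G i)] {X : Type*}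
  [MetricSpace X] [MulAction (∀ i, G i) X] [∀ i, MulAction (G i) X]
  (hs : ∀ (i : ι) (a : G i) (x : X), a • x = (Pi.mulSingle i a : ∀ j, G j) • x)
include hs

omit [MetricSpace X] in
theorem smul_smul_factor (i : ι) (g : ∀ j, G j) (a : G i) (x : X) :
    g • (a • x) = (g i * a * (g i)⁻¹) • (g • x) := by
  rw [hs, hs, smul_smul, smul_smul]
  congr 1
  ext j
  by_cases h : j = i
  · subst h; simp
  · simp [h]

omit [MetricSpace X] in
theorem smul_eq_smul_update (i : ι) (g : ∀ j, G j) (x : X) :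
    g • x = g i • (Function.update g i 1 • x) := by
  rw [hs, smul_smul]
  congr 1
  ext j
  by_cases h : j = i
  · subst h; simp
  · simp [h]

theorem IsMinimalSubspace.image_smul [IsIsometricSMul (∀ i, G i) X] [CompleteSpace X] {i : ι}
    {C : Set X} (hC : IsMinimalSubspace (G i) C) (hX : IsCAT0 X) (g : ∀ j, G j) :
    IsMinimalSubspace (G i) ((g • ·) '' C) :=
  hC.image hX hX (fun x _ y _ => dist_smul g x y)
    (fun a => ⟨_, fun x _ => smul_smul_factor hs i g a x⟩)
    fun a => ⟨(g i)⁻¹ * a * g i, fun x _ => by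
      simp only [smul_smul_factor hs i g]
      group⟩

/-- An element with trivial `i`-th entry commutes with `G i`, so its displacement is convex and `G
i`-invariant, and on the hull of `x` is at most its value at `x`. Writing `g` as `g i` times such an
element bounds all displacements by a continuous function of `g`. -/
theorem isTame_factor [∀ i, TopologicalSpace (G i)] [IsIsometricSMul (∀ i, G i) X]
    [ContinuousSMul (∀ i, G i) X] (hX : IsCAT0 X) (hG : ¬ IsEvanescent (∀ i, G i) X) (i : ι) :
    IsTame (G i) X := by
  intro x
  have hhull : ∀ g : ∀ j, G j, g i = 1 →
      orbitHull (G i) x ⊆ {t | dist (g • t) t ≤ dist (g • x) x} := by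
    intro g hg
    refine orbitHull_subset (IsCAT0.ClosedConvex.isInvariantSubspace (hX := hX)
      ⟨⟨x, le_refl (dist (g • x) x)⟩, ?_, fun y hy z hz => ?_⟩ fun a t ht => ?_)
      (le_refl (dist (g • x) x))
    · exact isClosed_le ((continuous_const_smul g).dist continuous_id) continuous_const
    · rw [Set.mem_ofPred_eq] at *
      rw [hX.smul_mid]
      linarith [hX.dist_mid_mid_le (g • y) (g • z) y z]
    · rw [Set.mem_ofPred_eq] at *
      rw [smul_smul_factor hs i g, hg]
      rw [one_mul, inv_one, mul_one, hs, hs, dist_smul]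
      exact ht
  refine isBounded_of_not_isEvanescent hG
    (b := fun g => dist (g i • x) x + dist (Function.update g i 1 • x) x) ?_ ?_
  · simp only [hs]
    have h₁ : Continuous fun g : ∀ j, G j => (Pi.mulSingle i (g i) : ∀ j, G j) :=
      (continuous_mulSingle i).comp (continuous_apply i)
    have h₂ : Continuous fun g : ∀ j, G j => Function.update g i (1 : G i) :=
      continuous_id.update i continuous_const
    exact ((h₁.smul continuous_const).dist continuous_const).add
      ((h₂.smul continuous_const).dist continuous_const)
  · rintro g t ⟨ht, ht'⟩
    have h₁ := ht (g i)
    have h₂ : dist (Function.update g i 1 • t) t ≤ dist (Function.update g i 1 • x) x :=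
      hhull _ (by simp) ht'
    have h₃ : dist (g • t) (g i • t) = dist (Function.update g i 1 • t) t := by
      rw [smul_eq_smul_update hs i g, hs i (g i), hs i (g i), dist_smul]
    linarith [dist_triangle (g • t) (g i • t) t]

variable [IsIsometricSMul (∀ i, G i) X] [∀ i, IsIsometricSMul (G i) X] [CompleteSpace X]
  (hX : IsCAT0 X) (hmin : IsMinimalSubspace (∀ i, G i) (Set.univ : Set X))
  (hT : ∀ i, IsTame (G i) X)
include hX hmin hT

/-- The product group permutes the minimal `G i`-subspaces, so their union is closed, convex and
invariant under the whole group, hence everything. -/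
theorem isMinimalSubspace_orbitHull (i : ι) (z : X) :
    IsMinimalSubspace (G i) (orbitHull (G i) z) := by
  obtain ⟨C, hC⟩ := (hT i).exists_isMinimalSubspace hX z
  obtain ⟨x, hx⟩ := hC.1.nonempty
  have := hmin.subset_of_midConvex hX (E := minimalUnion (G i) X) ⟨x, trivial, C, hC, hx⟩
    ((hT i).isClosed_minimalUnion hX)
    (fun x _ hx y _ hy => mid_mem_minimalUnion hX x hx y hy) (by
      rintro g x - ⟨C, hC, hx⟩
      exact ⟨_, IsMinimalSubspace.image_smul hs hC hX g, x, hx, rfl⟩)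
  obtain ⟨D, hD, hz⟩ := this (Set.mem_univ z)
  have hD : IsMinimalSubspace (G i) D := hD
  rwa [← hD.eq_orbitHull hX hz]

/-- The other factors act by `G i`-equivariant isometries between leaves; by rigidity these do not
change the coordinate. -/
theorem coord_smul (i : ι) (z₀ : X) (g : ∀ j, G j) (z : X) :
    coord (G i) z₀ (g • z) = g i • coord (G i) z₀ z := by
  have hK := isMinimalSubspace_orbitHull hs hX hmin hT i
  rw [smul_eq_smul_update hs i g]
  refine ((hK z₀).1.proj_smul hX _ _).trans (congrArg _ ?_)
  set h := Function.update g i 1 with hh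
  have hi : h i = 1 := by simp [hh]
  have heq : IsEquivIsomOn (G i) (orbitHull (G i) z) (h • ·) :=
    ⟨fun x _ y _ => dist_smul h x y, fun a x _ => by
      simp only [smul_smul_factor hs i h, hi]
      simp⟩
  exact (hT i).eq_proj_of_isEquivIsomOn hX (hK z) (hK z₀)
    (((IsMinimalSubspace.image_smul hs (hK z) hX h).isEquivIsomOn_proj (hK z₀) hX).comp heq
      (Set.mapsTo_image _ _))
    (fun _ _ => ((hK z₀).1.closedConvex hX).proj_mem _) (mem_orbitHull z)

/-- The level sets of the `j`-th coordinate are closed, convex and `G i`-invariant, so they contain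
the whole `G i`-leaf of each of their points. -/
theorem coord_setCoord_of_ne {i j : ι} (hij : j ≠ i) (z₀ y z : X) :
    coord (G j) z₀ (setCoord (G i) y z) = coord (G j) z₀ z := by
  have hK := isMinimalSubspace_orbitHull hs hX hmin hT
  refine (hK i z).subset_of_midConvex hX (E := {w | coord (G j) z₀ w = coord (G j) z₀ z})
    ⟨z, mem_orbitHull z, rfl⟩ (isClosed_eq (continuous_coord hX (hK j) z₀) continuous_const)
    (fun x _ hx y _ hy => ?_) (fun a x _ hx => ?_) (setCoord_mem hX (hK i) y z)
  · rw [Set.mem_ofPred_eq] at *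
    rw [(coord_mid_and_setCoord_mid (hT j) hX (hK j) z₀ x y).1, hx, hy, hX.mid_self]
  · rw [Set.mem_ofPred_eq] at *
    rw [hs, coord_smul hs hX hmin hT, Pi.mulSingle_eq_of_ne hij, one_smul, hx]

theorem setCoord_smul (i : ι) (z₀ : X) (g : ∀ j, G j) (z : X) :
    setCoord (G i) z₀ (g • z) = Function.update g i 1 • setCoord (G i) z₀ z := by
  have hK := isMinimalSubspace_orbitHull hs hX hmin hT i
  set h := Function.update g i 1 with hh
  have hi : h i = 1 := by simp [hh]
  have e₁ : orbitHull (G i) (g • z) = orbitHull (G i) (h • z) := by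
    apply orbitHull_eq_of_mem hX hK
    rw [smul_eq_smul_update hs i g]
    exact (hK (h • z)).1.smul_mem _ _ (mem_orbitHull _)
  have e₂ : (h • ·) '' orbitHull (G i) z = orbitHull (G i) (h • z) :=
    (IsMinimalSubspace.image_smul hs (hK z) hX h).eq_orbitHull hX ⟨z, mem_orbitHull z, rfl⟩
  have hmem : h • setCoord (G i) z₀ z ∈ orbitHull (G i) (g • z) := by
    rw [e₁, ← e₂]
    exact ⟨_, setCoord_mem hX hK z₀ z, rfl⟩
  have hc : coord (G i) z₀ (h • setCoord (G i) z₀ z) = z₀ := by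
    rw [coord_smul hs hX hmin hT, hi, one_smul, coord_setCoord hX hK (mem_orbitHull z₀)]
  rw [← (hK (g • z)).proj_proj (hK z₀) hX hmem]
  exact congrArg _ hc.symm

/-- The map `r` resets the coordinates in `S` to those of `z₀`. The extra clauses carry the
induction and make `r` invariant under the whole group once `S` is everything. -/
theorem exists_dist_sq_eq_sum_add (z₀ : X) (S : Finset ι) :
    ∃ r : X → X,
      (∀ z w, dist z w ^ 2 =
        ∑ i ∈ S, dist (coord (G i) z₀ z) (coord (G i) z₀ w) ^ 2 + dist (r z) (r w) ^ 2) ∧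
      (∀ i ∉ S, ∀ z, coord (G i) z₀ (r z) = coord (G i) z₀ z) ∧
      (∀ x y, r (hX.mid x y) = hX.mid (r x) (r y)) ∧
      ∀ (g : ∀ i, G i) (z : X), ∃ h : ∀ i, G i, (∀ i ∈ S, h i = 1) ∧ r (g • z) = h • r z := by
  have hK := isMinimalSubspace_orbitHull hs hX hmin hT
  induction S using Finset.induction_on with
  | empty => exact ⟨id, by simp, by simp, by simp, fun g z => ⟨g, by simp, rfl⟩⟩
  | insert a S ha ih =>
    obtain ⟨r, hr₁, hr₂, hr₃, hr₄⟩ := ih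
    refine ⟨setCoord (G a) z₀ ∘ r, fun z w => ?_, fun i hi z => ?_, fun x y => ?_, fun g z => ?_⟩
    · rw [hr₁, dist_sq_eq_coord_add (hT a) hX (hK a) z₀ (r z) (r w), Finset.sum_insert ha,
        hr₂ a ha, hr₂ a ha]
      simp only [Function.comp]
      ring
    · rw [Finset.mem_insert, not_or] at hi
      rw [Function.comp, coord_setCoord_of_ne hs hX hmin hT hi.1, hr₂ i hi.2]
    · simp only [Function.comp]
      rw [hr₃, (coord_mid_and_setCoord_mid (hT a) hX (hK a) z₀ _ _).2]
    · obtain ⟨h, h₁, h₂⟩ := hr₄ g z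
      refine ⟨Function.update h a 1, fun i hi => ?_, ?_⟩
      · by_cases hia : i = a
        · subst hia; simp
        · rw [Function.update_of_ne hia, h₁ i ((Finset.mem_insert.1 hi).resolve_left hia)]
      · simp only [Function.comp]
        rw [h₂, setCoord_smul hs hX hmin hT]

/-- With all coordinates reset, the fibre of `r` through `z₀` is closed, convex and invariant;
minimality makes `r` constant and the remainder vanishes. -/
theorem dist_sq_eq_sum [Fintype ι] (z₀ z w : X) :
    dist z w ^ 2 = ∑ i, dist (coord (G i) z₀ z) (coord (G i) z₀ w) ^ 2 := by
  obtain ⟨r, hr₁, -, hr₃, hr₄⟩ := exists_dist_sq_eq_sum_add hs hX hmin hT z₀ Finset.univ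
  have hle : ∀ z w, dist (r z) (r w) ≤ dist z w := fun z w => by
    refine le_of_sq_le_sq ?_ dist_nonneg
    rw [hr₁ z w]
    exact le_add_of_nonneg_left (Finset.sum_nonneg fun _ _ => sq_nonneg _)
  have hcont : Continuous r :=
    (LipschitzWith.of_dist_le_mul (K := 1) fun x y => by simpa using hle x y).continuous
  have hconst := hmin.subset_of_midConvex hX (E := {z | r z = r z₀}) ⟨z₀, trivial, rfl⟩
    (isClosed_eq hcont continuous_const)
    (fun x _ hx y _ hy => by
      rw [Set.mem_ofPred_eq] at *
      rw [hr₃, hx, hy, hX.mid_self])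
    (fun g x _ hx => by
      rw [Set.mem_ofPred_eq] at *
      obtain ⟨h, h₁, h₂⟩ := hr₄ g x
      have : h = 1 := funext fun i => h₁ i (Finset.mem_univ i)
      rw [h₂, this, one_smul, hx])
  have e : ∀ z, r z = r z₀ := fun z => hconst (Set.mem_univ z)
  rw [hr₁ z w, e z, e w, dist_self]
  simp

theorem exists_coord_eq [Fintype ι] (z₀ : X) (y : ι → X) (hy : ∀ i, y i ∈ orbitHull (G i) z₀) :
    ∃ z, ∀ i, coord (G i) z₀ z = y i := by
  have hK := isMinimalSubspace_orbitHull hs hX hmin hT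
  have : ∀ S : Finset ι, ∃ z, ∀ i ∈ S, coord (G i) z₀ z = y i := by
    intro S
    induction S using Finset.induction_on with
    | empty => exact ⟨z₀, by simp⟩
    | insert a S ha ih =>
      obtain ⟨z, hz⟩ := ih
      refine ⟨setCoord (G a) (y a) z, fun i hi => ?_⟩
      by_cases hia : i = a
      · subst hia
        exact coord_setCoord hX (hK i) (hy i) z
      · rw [coord_setCoord_of_ne hs hX hmin hT hia,
          hz i ((Finset.mem_insert.1 hi).resolve_left hia)]
  obtain ⟨z, hz⟩ := this Finset.univ
  exact ⟨z, fun i => hz i (Finset.mem_univ i)⟩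

end Product

/-! ### Assembly of the splitting and the dichotomy. -/

/-- A minimal non-evanescent space of a product of groups splits as a product of minimal spaces
of the factors. -/
theorem exists_splitting {n : ℕ} {G : Fin n → Type v} {X : Type u}
    [∀ i, Group (G i)] [∀ i, TopologicalSpace (G i)]
    [MetricSpace X] [CompleteSpace X] (hX : IsCAT0 X)
    [MulAction (∀ i, G i) X] [IsIsometricSMul (∀ i, G i) X] [ContinuousSMul (∀ i, G i) X]
    (hG : ¬ IsEvanescent (∀ i, G i) X)
    (hmin : IsMinimalSubspace (∀ i, G i) (Set.univ : Set X)) :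
    ∃ (Y : Fin n → Type u) (_ : ∀ i, MetricSpace (Y i)) (_ : ∀ i, MulAction (G i) (Y i))
      (α : X ≃ᵢ PiLp 2 Y),
      (∀ i, CompleteSpace (Y i)) ∧
      (∀ i, IsCAT0 (Y i)) ∧
      (∀ i, IsIsometricSMul (G i) (Y i)) ∧
      (∀ i, ContinuousSMul (G i) (Y i)) ∧
      (∀ i, IsMinimalSubspace (G i) (Set.univ : Set (Y i))) ∧
      ∀ (g : ∀ i, G i) (z : X) (i : Fin n), α (g • z) i = g i • α z i := by
  let act : ∀ i, MulAction (G i) X := fun i => MulAction.compHom X (MonoidHom.mulSingle G i)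
  have hs : ∀ (i : Fin n) (a : G i) (x : X), a • x = (Pi.mulSingle i a : ∀ j, G j) • x :=
    fun _ _ _ => rfl
  have hiso : ∀ i, IsIsometricSMul (G i) X := fun i =>
    ⟨fun a => isometry_smul X (Pi.mulSingle i a : ∀ j, G j)⟩
  have hcont : ∀ i, ContinuousSMul (G i) X := fun i =>
    ⟨((continuous_mulSingle i).comp continuous_fst).smul continuous_snd⟩
  have hT := isTame_factor hs hX hG
  have hK := isMinimalSubspace_orbitHull hs hX hmin hT
  obtain ⟨z₀, -⟩ := hmin.1.nonempty
  let Y : Fin n → Type u := fun i => orbitHull (G i) z₀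
  let f : X → PiLp 2 Y := fun z =>
    WithLp.toLp 2 fun i => (⟨coord (G i) z₀ z, coord_mem hX (hK i) z₀ z⟩ : Y i)
  have hf : Isometry f := Isometry.of_dist_eq fun z w => by
    rw [PiLp.dist_eq_sum (by simp), ← Real.sqrt_sq (dist_nonneg (x := z) (y := w)),
      dist_sq_eq_sum hs hX hmin hT z₀ z w, Real.sqrt_eq_rpow]
    simp only [ENNReal.toReal_ofNat, Real.rpow_ofNat]
    rfl
  have hsurj : ∀ y : PiLp 2 Y, ∃ z, f z = y := fun y => by
    obtain ⟨z, hz⟩ := exists_coord_eq hs hX hmin hT z₀ (fun i => ((y i : Y i) : X))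
      fun i => (y i).2
    exact ⟨z, PiLp.ext fun i => Subtype.ext (hz i)⟩
  choose inv hinv using hsurj
  refine ⟨Y, fun i => inferInstance, fun i => (hK i z₀).1.mulAction,
    IsometryEquiv.mk' f inv hinv hf, fun i => (hK i z₀).1.isClosed.completeSpace_coe,
    fun i => (hK i z₀).1.convex.isCAT0 hX, fun i => (hK i z₀).1.isIsometricSMul,
    fun i => (hK i z₀).1.continuousSMul, fun i => (hK i z₀).isMinimalSubspace_univ hX,
    fun g z i => Subtype.ext (coord_smul hs hX hmin hT i z₀ g z)⟩

end CatZero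

theorem theorem9 {n : ℕ} {G : Fin n → Type v} {X : Type u}
    [∀ i, Group (G i)] [∀ i, TopologicalSpace (G i)] [∀ i, IsTopologicalGroup (G i)]
    [MetricSpace X] [CompleteSpace X] [Nonempty X] (hX : CatZero.IsCAT0 X)
    [MulAction (∀ i, G i) X] [IsIsometricSMul (∀ i, G i) X] [ContinuousSMul (∀ i, G i) X] :
    CatZero.IsEvanescent (∀ i, G i) X ∨
    ∃ Z : Set X,
      -- `Z` is a non-empty closed convex invariant subspace
      CatZero.IsInvariantSubspace (∀ i, G i) Z ∧
      -- `Z` is canonical: it is the unique circumcentre of the space of components,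
      -- and it is preserved by all isometries of `X` that normalise the action
      CatZero.IsCentralComponent (∀ i, G i) Z ∧
      (∀ Z' : Set X, CatZero.IsCentralComponent (∀ i, G i) Z' → Z' = Z) ∧
      (∀ (φ : X ≃ᵢ X) (ψ : (∀ i, G i) ≃* (∀ i, G i)),
        (∀ (g : ∀ i, G i) (x : X), φ (g • x) = ψ g • φ x) → φ '' Z = Z) ∧
      -- `Z` splits equivariantly and isometrically as the `ℓ²`-product of minimal `G i`-spaces
      ∃ (Y : Fin n → Type u) (_ : ∀ i, MetricSpace (Y i)) (_ : ∀ i, MulAction (G i) (Y i))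
        (α : Z ≃ᵢ PiLp 2 Y),
        (∀ i, CompleteSpace (Y i)) ∧
        (∀ i, CatZero.IsCAT0 (Y i)) ∧
        (∀ i, IsIsometricSMul (G i) (Y i)) ∧
        (∀ i, ContinuousSMul (G i) (Y i)) ∧
        (∀ i, CatZero.IsMinimalSubspace (G i) (Set.univ : Set (Y i))) ∧
        (∀ (g : ∀ i, G i) (z w : Z), (w : X) = g • (z : X) →
          ∀ i, α w i = g i • α z i) := by
  by_cases hG : CatZero.IsEvanescent (∀ i, G i) X
  · exact Or.inl hG
  obtain ⟨Z, hZ, huniq⟩ := CatZero.exists_unique_isCentralComponent (H := ∀ i, G i) hX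
    (CatZero.isBounded_subDisplacement hG)
  have hinv := hZ.1.1
  let := hinv.mulAction
  have := hinv.isIsometricSMul
  have := hinv.continuousSMul
  have : CompleteSpace Z := hinv.isClosed.completeSpace_coe
  obtain ⟨Y, mY, aY, α, hc, hcat, hiso, hcont, hmin, hα⟩ :=
    CatZero.exists_splitting (G := G) (X := Z) (hinv.convex.isCAT0 hX)
      (fun h => hG (CatZero.IsEvanescent.of_subtype hinv h)) (hZ.1.isMinimalSubspace_univ hX)
  refine Or.inr ⟨Z, hinv, hZ, huniq, fun φ ψ h => huniq _ (hZ.image_isometryEquiv hX φ ψ h),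
    Y, mY, aY, α, hc, hcat, hiso, hcont, hmin, fun g z w hw i => ?_⟩
  have : w = g • z := Subtype.ext hw
  rw [this, hα]
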